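/- Let $(M,g)$ be a smooth, connected, closed Riemannian manifold of dimension $n\ge 5$, with injectivity radius $i_g(M)$; fix $r_g\in(0,i_g(M))$ and a smooth cutoff $\chi:\mathbb R\to\mathbb R$ with $\chi(t)=1$ for $|t|\le r_g/2$ and $\chi(t)=0$ for $|t|\ge r_g$. Let $2^\star=\frac{2n}{n-2}$, let $D^{1,2}(\mathbb R^n)$ be the completion of $C_c^\infty(\mathbb R^n)$ for $\|\nabla u\|_2$ (realised in $L^{2^\star}(\mathbb R^n)$), and let $\Sigma$ be the set of non-zero $V\in D^{1,2}(\mathbb R^n)$ solving $-\sum_{i}\partial_i^2V=|V|^{2^\star-2}V$ (weakly) in $\mathbb R^n$. Let $$B_0^+(x)=\Big(1+\tfrac{|x|^2}{n(n-2)}\Big)^{-\frac{n-2}{2}} .$$ A family $B=(B_\varepsilon)_{\varepsilon>0}$ in $H^1(M)$ is a family of bubbles centered at $x_\varepsilon\in M$, with radius $\mu_\varepsilon>0$ and modeled on $V\in\Sigma$ if, as $\varepsilon\to0$, $\mu_\varepsilon\to0$, $x_\varepsilon\to x_0\in M$, and there are $R\in(r_g,i_g(M))$ and smooth charts $\varphi_\varepsilon:B_g(x_0,R)\to\mathbb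 R^n$, $\varepsilon\ge0$, with $\varphi_\varepsilon$ normal at $x_\varepsilon$ for all small $\varepsilon>0$, $\varphi_\varepsilon\to\varphi_0$ in $C^k$ on compact sets for every $k$, and $$B_\varepsilon-\chi(d_g(\cdot,x_\varepsilon))\,\mu_\varepsilon^{-\frac{n-2}2}\,V\Big(\frac{\varphi_\varepsilon(\cdot)-\varphi_\varepsilon(x_\varepsilon)}{\mu_\varepsilon}\Big)\to0\quad\text{in }H^1(M).$$ For such a family put (sums over repeated indices, derivatives of $V$ in the weak sense) $$\mathrm{Weyl}_g\otimes B:=\frac{4n}{3(n-2)^2}\Big(\int_{\mathbb R^n}|V|^{2^\star}dx\Big)^{-1}\mathrm{Weyl}_g(x_0)_{i\alpha j\beta}\int_{\mathbb R^n}x^\alpha x^\beta\,\partial_{ij}^2V\Big(\frac{n-2}2V+x^l\partial_lV\Big)dx,$$ where $\mathrm{Weyl}_g$ is the $(4,0)$ Weyl tensor of $g$ and its components at $x_0$ are taken in an exponential chart at $x_0$, that is, with respect to an orthonormal basis of $T_{x_0}M$. **Proposition.** Let $B$ be a family of bubbles centered at $x_\varepsilon$, with radius $\mu_\varepsilon$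 and modeled on $V\in\Sigma$, and let $x_0=\lim_{\varepsilon\to0}x_\varepsilon$. 1. If $\mathrm{Weyl}_g(x_0)=0$, then $\mathrm{Weyl}_g\otimes B=0$ (for every choice of the exponential chart at $x_0$). 2. If $V$ is radial, that is, $V(x)$ depends only on $|x|$ (up to a null set), then $V$ is the standard bubble up to sign and dilation: there are $\sigma\in\{1,-1\}$ and $s>0$ with $V(x)=\sigma\,s^{\frac{n-2}2}B_0^+(sx)$ for almost every $x$. Moreover, the integrals $\int_{\mathbb R^n}x^\alpha x^\beta\,\partial_{ij}^2V\big(\frac{n-2}2V+x^l\partial_lV\big)dx$ converge absolutely for all $i,\alpha,j,\beta$, and $\mathrm{Weyl}_g\otimes B=0$ (for every choice of the exponential chart at $x_0$). -/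

import Mathlib

open Set Filter Topology MeasureTheory Manifold Bundle
open scoped ENNReal ContDiff

noncomputable section

namespace WeylBubble

/-! ## Euclidean analysis -/

/-- The Euclidean space `ℝⁿ`. -/
abbrev Eucl (n : ℕ) : Type := EuclideanSpace ℝ (Fin n)

/-- The `i`-th vector of the canonical basis of `ℝⁿ`. -/
def stdVec {n : ℕ} (i : Fin n) : Eucl n := EuclideanSpace.single i (1 : ℝ)

/-- The classical partial derivative `∂ᵢ f (y)`. -/
def partialDeriv {n : ℕ} (i : Fin n) (f : Eucl n → ℝ) (y : Eucl n) : ℝ :=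
  fderiv ℝ f y (stdVec i)

/-- Test functions: elements of `C_c^∞(ℝⁿ)`. -/
def IsTestFunction {n : ℕ} (φ : Eucl n → ℝ) : Prop :=
  ContDiff ℝ ∞ φ ∧ HasCompactSupport φ

/-- `g` is a weak (distributional) partial derivative `∂ᵢ u` of the locally integrable `u`. -/
def IsWeakPartial {n : ℕ} (i : Fin n) (u g : Eucl n → ℝ) : Prop :=
  LocallyIntegrable u ∧ LocallyIntegrable g ∧
    ∀ φ : Eucl n → ℝ, IsTestFunction φ →
      ∫ x, u x * partialDeriv i φ x = - ∫ x, g x * φ x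

open Classical in
/-- The weak partial derivative `∂ᵢ u`, unique up to a null set (and `0` if there is none). For a
function with a representative of class `C¹` it is the classical partial derivative of it. -/
def weakPartial {n : ℕ} (i : Fin n) (u : Eucl n → ℝ) : Eucl n → ℝ :=
  if h : ∃ g, IsWeakPartial i u g then h.choose else 0

/-- The critical Sobolev exponent `2* = 2n/(n-2)`. -/
def twoStar (n : ℕ) : ℝ := 2 * n / (n - 2)

/-- `V` belongs to `D^{1,2}(ℝⁿ)` and has gradient `G`. Here `D^{1,2}(ℝⁿ)`, the completion of
`C_c^∞(ℝⁿ)` for `‖∇u‖₂`, is realised as usual as a space of functions in `L^{2*}` through the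
Sobolev inequality: `V` is the limit in `L^{2*}` of test functions whose gradients converge
in `L²` to `G`. -/
def HasD12Gradient {n : ℕ} (V : Eucl n → ℝ) (G : Eucl n → Eucl n) : Prop :=
  MemLp V (ENNReal.ofReal (twoStar n)) ∧ MemLp G 2 ∧
    ∃ φ : ℕ → Eucl n → ℝ, (∀ k, IsTestFunction (φ k)) ∧
      Tendsto (fun k => eLpNorm (φ k - V) (ENNReal.ofReal (twoStar n))) atTop (𝓝 0) ∧
      Tendsto (fun k => eLpNorm (fun x => gradient (φ k) x - G x) 2) atTop (𝓝 0)

/-- The set `Σ` of non-zero finite-energy solutions `V ∈ D^{1,2}(ℝⁿ)` of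
`-∑ ∂ᵢ² V = |V|^{2*-2} V` in `ℝⁿ`; the equation holds in the weak sense. -/
def MemSigma {n : ℕ} (V : Eucl n → ℝ) : Prop :=
  (¬ V =ᵐ[volume] 0) ∧
    ∃ G : Eucl n → Eucl n, HasD12Gradient V G ∧
      ∀ φ : Eucl n → ℝ, IsTestFunction φ →
        ∫ x, inner ℝ (G x) (gradient φ x) = ∫ x, |V x| ^ (twoStar n - 2) * V x * φ x

/-- `V` is radial: up to a null set, `V x` is a function of `|x|`. -/
def IsRadial {n : ℕ} (V : Eucl n → ℝ) : Prop :=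
  ∃ v : ℝ → ℝ, V =ᵐ[volume] fun x => v ‖x‖

/-- The standard bubble `B₀⁺(x) = (1 + |x|²/(n(n-2)))^{-(n-2)/2}`. -/
def standardBubble (n : ℕ) (x : Eucl n) : ℝ :=
  (1 + ‖x‖ ^ 2 / ((n : ℝ) * (n - 2))) ^ (-(((n : ℝ) - 2) / 2))

/-! ## Riemannian geometry in coordinates -/

section Riemannian

variable {n : ℕ} {M : Type*} [MetricSpace M] [ChartedSpace (Eucl n) M]

/-- The coordinates at `p` of `v ∈ T_p M` in the preferred chart at `p`. -/
def coordVec (p : M) (v : TangentSpace (𝓡 n) p) : Eucl n :=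
  mfderiv (𝓡 n) 𝓘(ℝ, Eucl n) (chartAt (Eucl n) p) p v

/-- The coordinate vector field `∂ᵢ` of the preferred chart at `p`, at the point of coordinates
`y`. -/
def coordField (p : M) (y : Eucl n) (i : Fin n) :
    TangentSpace (𝓡 n) ((chartAt (Eucl n) p).symm y) :=
  mfderiv 𝓘(ℝ, Eucl n) (𝓡 n) (chartAt (Eucl n) p).symm y (stdVec i)

variable [RiemannianBundle (fun x : M => TangentSpace (𝓡 n) x)]

/-- The coefficients `g_{ij}` of the metric in the preferred chart at `p`. -/
def metricCoeff (p : M) (i j : Fin n) (y : Eucl n) : ℝ :=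
  inner ℝ (coordField p y i) (coordField p y j)

/-- The coefficients `g^{ij}` of the inverse metric. -/
def invMetricCoeff (p : M) (i j : Fin n) (y : Eucl n) : ℝ :=
  (Matrix.of fun a b => metricCoeff p a b y)⁻¹ i j

/-- The Christoffel symbols
`Γ^k_{ij} = ½ g^{kl} (∂ᵢ g_{jl} + ∂ⱼ g_{il} - ∂ₗ g_{ij})` of the Levi-Civita connection. -/
def christoffel (p : M) (k i j : Fin n) (y : Eucl n) : ℝ :=
  (1 / 2) * ∑ l, invMetricCoeff p k l y *
    (partialDeriv i (metricCoeff p j l) y + partialDeriv j (metricCoeff p i l) y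
      - partialDeriv l (metricCoeff p i j) y)

/-- The `(4,0)` Riemann tensor `Rm_{ijkl} = g(R(∂ᵢ,∂ⱼ)∂ₗ, ∂ₖ)`, where
`R(∂ᵢ,∂ⱼ) = [∇ᵢ, ∇ⱼ]`. With this convention the round unit sphere has
`Rm_{ijkl} = g_{ik} g_{jl} - g_{il} g_{jk}`. -/
def riemannCoeff (p : M) (i j k l : Fin n) (y : Eucl n) : ℝ :=
  ∑ m, metricCoeff p k m y *
    (partialDeriv i (christoffel p m j l) y - partialDeriv j (christoffel p m i l) y
      + ∑ s, (christoffel p s j l y * christoffel p m i s y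
        - christoffel p s i l y * christoffel p m j s y))

/-- The Ricci tensor `Ric_{jl} = g^{ik} Rm_{ijkl}`. -/
def ricciCoeff (p : M) (j l : Fin n) (y : Eucl n) : ℝ :=
  ∑ i, ∑ k, invMetricCoeff p i k y * riemannCoeff p i j k l y

/-- The scalar curvature `S_g = g^{jl} Ric_{jl}`. -/
def scalarCurv (p : M) (y : Eucl n) : ℝ :=
  ∑ j, ∑ l, invMetricCoeff p j l y * ricciCoeff p j l y

/-- The Kulkarni-Nomizu product
`(T ⊙ S)_{ijkl} = T_{ik}S_{jl} - T_{il}S_{jk} + T_{jl}S_{ik} - T_{jk}S_{il}`. -/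
def kulkarniNomizu (T S : Fin n → Fin n → ℝ) (i j k l : Fin n) : ℝ :=
  T i k * S j l - T i l * S j k + T j l * S i k - T j k * S i l

/-- The coefficients of the `(4,0)` Weyl tensor
`Weyl = Rm - 1/(n-2) Ric ⊙ g + S_g/(2(n-1)(n-2)) g ⊙ g` in the preferred chart at `p`. -/
def weylCoeff (p : M) (i j k l : Fin n) (y : Eucl n) : ℝ :=
  riemannCoeff p i j k l y
    - 1 / ((n : ℝ) - 2) *
      kulkarniNomizu (fun a b => ricciCoeff p a b y) (fun a b => metricCoeff p a b y) i j k l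
    + scalarCurv p y / (2 * ((n : ℝ) - 1) * ((n : ℝ) - 2)) *
      kulkarniNomizu (fun a b => metricCoeff p a b y) (fun a b => metricCoeff p a b y) i j k l

/-- The Weyl tensor `Weyl_g(p)`, as a function of four tangent vectors at `p`. -/
def weylTensor (p : M) (u v w z : TangentSpace (𝓡 n) p) : ℝ :=
  ∑ a, ∑ b, ∑ c, ∑ d, weylCoeff p a b c d (chartAt (Eucl n) p p) *
    coordVec p u a * coordVec p v b * coordVec p w c * coordVec p z d

/-- `γ : ℝ → M` is a geodesic: it is smooth, and at every time `t` it satisfies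
`c''^k + Γ^k_{ij} c'^i c'^j = 0`, `c` being `γ` read in the preferred chart at `γ t`. -/
def IsGeodesic (γ : ℝ → M) : Prop :=
  ContMDiff 𝓘(ℝ, ℝ) (𝓡 n) ∞ γ ∧
    ∀ (t : ℝ) (k : Fin n),
      deriv (deriv fun s => chartAt (Eucl n) (γ t) (γ s)) t k
        + ∑ i, ∑ j, christoffel (γ t) k i j (chartAt (Eucl n) (γ t) (γ t)) *
          deriv (fun s => chartAt (Eucl n) (γ t) (γ s)) t i *
          deriv (fun s => chartAt (Eucl n) (γ t) (γ s)) t j = 0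

/-- `γ` is a geodesic with `γ(0) = p` and `γ'(0) = v`. -/
def IsGeodesicFrom (p : M) (v : TangentSpace (𝓡 n) p) (γ : ℝ → M) : Prop :=
  IsGeodesic (n := n) γ ∧ γ 0 = p ∧
    deriv (fun s => chartAt (Eucl n) p (γ s)) 0 = coordVec p v

open Classical in
/-- The exponential map `exp_p : T_p M → M` (geodesics of a closed manifold exist for all times and
are unique). -/
def riemExp (p : M) (v : TangentSpace (𝓡 n) p) : M :=
  if h : ∃ γ, IsGeodesicFrom p v γ then h.choose 1 else p

variable (n M) in
/-- The injectivity radius `i_g(M)`: the supremum of all `r` such that, for every point `p`, the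
restriction of `exp_p` to the ball of radius `r` of `T_p M` is a diffeomorphism onto its image
(an injective local diffeomorphism). -/
def injectivityRadius : ℝ≥0∞ :=
  sSup {r : ℝ≥0∞ | ∀ (p : M) (ι : Eucl n ≃ₗᵢ[ℝ] TangentSpace (𝓡 n) p),
    InjOn (fun v : Eucl n => riemExp p (ι v)) (Metric.eball 0 r) ∧
      IsLocalDiffeomorphOn 𝓘(ℝ, Eucl n) (𝓡 n) ∞ (fun v : Eucl n => riemExp p (ι v))
        (Metric.eball 0 r)}

/-- The chart `φ` is normal at `p`: on its domain, `φ - φ(p)` is the inverse of `exp_p` followed by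
a linear isometry `T_p M → ℝⁿ`. (The inverse of `exp_p` selects the shortest vector, whose length is
the distance to `p`.) -/
def IsNormalChart (φ : OpenPartialHomeomorph M (Eucl n)) (p : M) : Prop :=
  p ∈ φ.source ∧
    ∃ ι : Eucl n ≃ₗᵢ[ℝ] TangentSpace (𝓡 n) p,
      ∀ x ∈ φ.source, riemExp p (ι (φ x - φ p)) = x ∧ dist p x = ‖φ x - φ p‖

/-- The norm `|∇u|_g(x) = |du(x)|_g` of the gradient of a smooth function `u : M → ℝ`, that is the
supremum of `du(x)(v)` for `|v|_g ≤ 1`. -/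
def gradNorm (n : ℕ) {M : Type*} [MetricSpace M] [ChartedSpace (Eucl n) M]
    [RiemannianBundle (fun x : M => TangentSpace (𝓡 n) x)] (u : M → ℝ) (x : M) : ℝ :=
  sSup {s : ℝ | ∃ v : TangentSpace (𝓡 n) x, ‖v‖ ≤ 1 ∧ s = mfderiv (𝓡 n) 𝓘(ℝ, ℝ) u x v}

variable [MeasurableSpace M] [BorelSpace M]

variable (n) in
/-- The norm `‖u‖₂ + ‖∇u‖₂` of a smooth function on `M`. The Riemannian measure is
the `n`-dimensional Hausdorff measure of the Riemannian distance, normalised so as to be the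
Lebesgue measure on `ℝⁿ`. -/
def smoothH1Norm (u : M → ℝ) : ℝ≥0∞ :=
  eLpNorm u 2 (μHE[n] : Measure M) + eLpNorm (gradNorm n u) 2 (μHE[n] : Measure M)

variable (n) in
/-- The sequence `u` of smooth functions is Cauchy for `‖u‖₂ + ‖∇u‖₂` and converges in `L²(M)`
to `f`, that is, it represents `f` in the completion `H¹(M)`. -/
def IsH1Approx (u : ℕ → M → ℝ) (f : M → ℝ) : Prop :=
  (∀ k, ContMDiff (𝓡 n) 𝓘(ℝ, ℝ) ∞ (u k)) ∧
    (∀ δ : ℝ≥0∞, 0 < δ → ∃ N : ℕ, ∀ k ≥ N, ∀ l ≥ N, smoothH1Norm n (u k - u l) ≤ δ) ∧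
    Tendsto (fun k => eLpNorm (u k - f) 2 (μHE[n] : Measure M)) atTop (𝓝 0)

variable (n) in
/-- `f ∈ H¹(M)`, the completion of `C^∞(M)` for `‖u‖₂ + ‖∇u‖₂`. -/
def MemH1 (f : M → ℝ) : Prop :=
  AEStronglyMeasurable f (μHE[n] : Measure M) ∧ ∃ u, IsH1Approx n u f

variable (n) in
/-- The norm of `f ∈ H¹(M)` (all the approximating sequences give the same value). -/
def h1Norm (f : M → ℝ) : ℝ≥0∞ :=
  ⨅ (u : ℕ → M → ℝ) (_ : IsH1Approx n u f), limsup (fun k => smoothH1Norm n (u k)) atTop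

variable (n) in
/-- `f_ε → 0` in `H¹(M)` as `ε → 0⁺`. -/
def TendstoZeroH1 (f : ℝ → M → ℝ) : Prop :=
  (∀ᶠ ε in 𝓝[>] (0 : ℝ), MemH1 n (f ε)) ∧
    Tendsto (fun ε => h1Norm n (f ε)) (𝓝[>] 0) (𝓝 0)

/-- The family of charts `φ_ε` converges to `φ_0` as `ε → 0⁺`, in `C^k` on compact sets for all `k`
(read in the chart `φ_0`). -/
def ChartsConverge (φ : ℝ → OpenPartialHomeomorph M (Eucl n)) : Prop :=
  ∀ k : ℕ, TendstoLocallyUniformlyOn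
    (fun ε => iteratedFDeriv ℝ k (fun y => φ ε ((φ 0).symm y)))
    (iteratedFDeriv ℝ k (fun y => φ 0 ((φ 0).symm y))) (𝓝[>] 0) (φ 0).target

/-- The function
`χ(d_g(·, x_ε)) μ_ε^{-(n-2)/2} V((φ_ε(·) - φ_ε(x_ε)) / μ_ε)`. -/
def bubbleProfile (χ : ℝ → ℝ) (φ : OpenPartialHomeomorph M (Eucl n)) (p : M) (m : ℝ)
    (V : Eucl n → ℝ) (x : M) : ℝ :=
  χ (dist x p) * m ^ (-(((n : ℝ) - 2) / 2)) * V (m⁻¹ • (φ x - φ p))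

/-- `B = (B_ε)_{ε > 0}` is a family of bubbles centered at `x_ε`, with radius `μ_ε` and modeled
on `V ∈ Σ`, with `x₀ = lim x_ε`. The charts `φ_ε` are defined on a geodesic ball of centre `x₀` and
radius `R ∈ (r_g, i_g(M))`; so, for `ε` small, their domain contains the ball of centre `x_ε` and
radius `r_g` outside of which the cutoff `χ(d_g(·, x_ε))` vanishes. -/
structure IsBubbleFamily (r : ℝ) (χ : ℝ → ℝ) (B : ℝ → M → ℝ) (x : ℝ → M) (μ : ℝ → ℝ)
    (V : Eucl n → ℝ) (x₀ : M) : Prop where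
  radius_pos : ∀ ε > 0, 0 < μ ε
  radius_tendsto : Tendsto μ (𝓝[>] 0) (𝓝 0)
  center_tendsto : Tendsto x (𝓝[>] 0) (𝓝 x₀)
  memSigma : MemSigma V
  memH1 : ∀ ε > 0, MemH1 n (B ε)
  exists_charts : ∃ (R : ℝ) (φ : ℝ → OpenPartialHomeomorph M (Eucl n)),
    r < R ∧ ENNReal.ofReal R < injectivityRadius n M ∧
    (∀ ε ≥ 0, φ ε ∈ IsManifold.maximalAtlas (𝓡 n) ∞ M ∧ (φ ε).source = Metric.ball x₀ R) ∧
    (∀ᶠ ε in 𝓝[>] (0 : ℝ), IsNormalChart (φ ε) (x ε)) ∧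
    ChartsConverge φ ∧
    TendstoZeroH1 n (fun ε y => B ε y - bubbleProfile χ (φ ε) (x ε) (μ ε) V y)

end Riemannian

/-! ## The product of the Weyl tensor and a family of bubbles -/

/-- The function `x^α x^β ∂²_{ij} V ((n-2)/2 V + x^l ∂_l V)` on `ℝⁿ`. -/
def weylIntegrand {n : ℕ} (V : Eucl n → ℝ) (i α j β : Fin n) (x : Eucl n) : ℝ :=
  x α * x β * weakPartial i (weakPartial j V) x *
    (((n : ℝ) - 2) / 2 * V x + ∑ l, x l * weakPartial l V x)

/-- The number `Weyl_g ⊗ B` for a family of bubbles `B` modeled on `V` whose centers converge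
to `x₀`:
`4n/(3(n-2)²) (∫ |V|^{2*})⁻¹ Weyl_g(x₀)_{iαjβ} ∫ x^α x^β ∂²_{ij} V ((n-2)/2 V + x^l ∂_l V) dx`.
The linear isometry `ι` is the chosen identification of `ℝⁿ` with `T_{x₀} M`. The components of
`Weyl_g(x₀)` are taken in the exponential chart given by `v ↦ exp_{x₀}(ι v)`, whose coordinate
vectors at `x₀` are the `ι eᵢ`. -/
def weylProduct {n : ℕ} {M : Type*} [MetricSpace M] [ChartedSpace (Eucl n) M]
    [RiemannianBundle (fun x : M => TangentSpace (𝓡 n) x)]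
    (x₀ : M) (ι : Eucl n ≃ₗᵢ[ℝ] TangentSpace (𝓡 n) x₀) (V : Eucl n → ℝ) : ℝ :=
  4 * (n : ℝ) / (3 * ((n : ℝ) - 2) ^ 2) * (∫ x, |V x| ^ twoStar n)⁻¹ *
    ∑ i, ∑ α, ∑ j, ∑ β,
      weylTensor x₀ (ι (stdVec i)) (ι (stdVec α)) (ι (stdVec j)) (ι (stdVec β)) *
        ∫ x, weylIntegrand V i α j β x

end WeylBubble

end

/-! Part 1 is immediate: `weylProduct` is linear in the components of the Weyl tensor. Part 2
combines a classification of the radial elements of `Σ` with a pointwise cancellation.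

Classification. Put `γ = (n-2)/2`, `p = 2*`, and write `V(x) = v(|x|)`, `w(t) = e^{γt} v(e^t)`
(Emden-Fowler variables). The equation becomes the autonomous `w'' = γ² w - |w|^{p-2} w` on the
line, and `V ∈ L^{2*}` becomes `w ∈ L^p(ℝ)` because `γp = n`. The weak equation is tested only on
radial functions supported away from the origin, so no regularity of `V` at `0` is needed;
one-dimensional distribution theory then makes `w` a classical solution
(`exists_classical_solution`). The energy `w'²/2 - γ²w²/2 + |w|^p/p` is constant, and integrability
forces it to vanish (`energy_eq_zero`). Hence `|w'| ≤ γ|w|`, so a solution that is not identically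
zero has no zero and keeps its sign. For `w > 0` at zero energy, `u = w^{-1/γ}` solves the linear
equation `u'' = u`; thus `u = a e^t + b e^{-t}`, with `ab` fixed by the energy relation
(`eq_of_pos_of_energy`). Back in `ℝⁿ` this is a dilated standard bubble.

Cancellation. The Hessian of a radial function has the form `a δᵢⱼ + b xᵢ xⱼ`. Contracted with
`Weyl_{iαjβ} x^α x^β`, the first term dies because Weyl is trace-free and the second because Weyl is
antisymmetric in `i, α` (`sum_weylTensor_radial`). The sum of the integrands therefore vanishes
pointwise. To pass this to the sum of the integrals each must converge; the integrands are
`O(|x|^{-2(n-2)})` at infinity, which is integrable precisely because `n > 4`. -/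

noncomputable section

namespace WeylBubble

/-! ### Antisymmetry and trace of the Weyl tensor in an orthonormal frame -/

section Frame

variable {n : ℕ} {M : Type*} [MetricSpace M] [ChartedSpace (Eucl n) M]
  [RiemannianBundle (fun x : M => TangentSpace (𝓡 n) x)]

theorem metricCoeff_comm (p : M) (i j : Fin n) (y : Eucl n) :
    metricCoeff p i j y = metricCoeff p j i y :=
  real_inner_comm _ _

/-- Of the symmetries of curvature only this one, visible in the coordinate formula, is needed;
neither pair symmetry nor the Bianchi identity enters. -/
theorem riemannCoeff_swap (p : M) (i j k l : Fin n) (y : Eucl n) :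
    riemannCoeff p i j k l y = -riemannCoeff p j i k l y := by
  unfold riemannCoeff
  rw [← Finset.sum_neg_distrib]
  refine Finset.sum_congr rfl fun m _ => ?_
  rw [Finset.sum_sub_distrib, Finset.sum_sub_distrib]
  ring

theorem kulkarniNomizu_swap (T S : Fin n → Fin n → ℝ) (i j k l : Fin n) :
    kulkarniNomizu T S i j k l = -kulkarniNomizu T S j i k l := by
  unfold kulkarniNomizu; ring

theorem weylCoeff_swap (p : M) (i j k l : Fin n) (y : Eucl n) :
    weylCoeff p i j k l y = -weylCoeff p j i k l y := by
  unfold weylCoeff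
  rw [riemannCoeff_swap, kulkarniNomizu_swap _ _ i, kulkarniNomizu_swap (fun a b =>
    metricCoeff p a b y) _ i]
  ring

theorem weylTensor_swap (p : M) (u v w z : TangentSpace (𝓡 n) p) :
    weylTensor p u v w z = -weylTensor p v u w z := by
  unfold weylTensor
  rw [Finset.sum_comm]
  simp only [← Finset.sum_neg_distrib]
  refine Finset.sum_congr rfl fun a _ => Finset.sum_congr rfl fun b _ =>
    Finset.sum_congr rfl fun c _ => Finset.sum_congr rfl fun d _ => ?_
  rw [weylCoeff_swap p b a]
  ring

/-- The Kulkarni-Nomizu product with a metric `g`, traced over the first and third indices. -/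
theorem sum_mul_kulkarniNomizu (g h : Matrix (Fin n) (Fin n) ℝ) (hg : ∀ i j, g i j = g j i)
    (hhg : h * g = 1) (T : Fin n → Fin n → ℝ) (j l : Fin n) :
    ∑ i, ∑ k, h i k * kulkarniNomizu T (fun a b => g a b) i j k l
      = (∑ i, ∑ k, h i k * T i k) * g j l + ((n : ℝ) - 2) * T j l := by
  have hgh : g * h = 1 := mul_eq_one_comm.mp hhg
  have e1 : ∀ i m, ∑ k, h i k * g m k = if i = m then 1 else 0 := fun i m => by
    rw [← Matrix.one_apply, ← hhg, Matrix.mul_apply]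
    exact Finset.sum_congr rfl fun k _ => by rw [hg m k]
  have e2 : ∀ k m, ∑ i, h i k * g i m = if m = k then 1 else 0 := fun k m => by
    rw [← Matrix.one_apply, ← hgh, Matrix.mul_apply]
    exact Finset.sum_congr rfl fun i _ => by rw [hg m i, mul_comm]
  have t1 : ∑ i, ∑ k, h i k * (T i k * g j l) = (∑ i, ∑ k, h i k * T i k) * g j l := by
    simp only [Finset.sum_mul, mul_assoc]
  have t2 : ∑ i, ∑ k, h i k * (T i l * g j k) = T j l := by
    have : ∀ i, ∑ k, h i k * (T i l * g j k) = T i l * ∑ k, h i k * g j k := fun i => by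
      rw [Finset.mul_sum]; exact Finset.sum_congr rfl fun k _ => by ring
    simp [this, e1]
  have t3 : ∑ i, ∑ k, h i k * (T j l * g i k) = n * T j l := by
    have : ∀ i, ∑ k, h i k * (T j l * g i k) = T j l * ∑ k, h i k * g i k := fun i => by
      rw [Finset.mul_sum]; exact Finset.sum_congr rfl fun k _ => by ring
    simp [this, e1]
  have t4 : ∑ i, ∑ k, h i k * (T j k * g i l) = T j l := by
    rw [Finset.sum_comm]
    have : ∀ k, ∑ i, h i k * (T j k * g i l) = T j k * ∑ i, h i k * g i l := fun i => by
      rw [Finset.mul_sum]; exact Finset.sum_congr rfl fun k _ => by ring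
    simp [this, e2]
  simp only [kulkarniNomizu, mul_add, mul_sub, Finset.sum_add_distrib, Finset.sum_sub_distrib,
    t1, t2, t3, t4]
  ring

/-- The Weyl tensor is trace-free. -/
theorem sum_invMetricCoeff_mul_weylCoeff (hn : 3 ≤ n) (p : M) (y : Eucl n)
    (h : (Matrix.of fun a b => invMetricCoeff p a b y) * (Matrix.of fun a b => metricCoeff p a b y)
      = 1) (j l : Fin n) :
    ∑ i, ∑ k, invMetricCoeff p i k y * weylCoeff p i j k l y = 0 := by
  have hn' : (3 : ℝ) ≤ n := by exact_mod_cast hn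
  have key := sum_mul_kulkarniNomizu _ _
    (fun i j => show metricCoeff p i j y = metricCoeff p j i y from metricCoeff_comm p i j y) h
  simp only [Matrix.of_apply] at key
  have hone : ∑ i, ∑ k, invMetricCoeff p i k y * metricCoeff p i k y = n := by
    have : ∀ i, ∑ k, invMetricCoeff p i k y * metricCoeff p i k y = 1 := fun i => by
      have := congrFun (congrFun h i) i
      rw [Matrix.mul_apply, Matrix.one_apply_eq] at this
      rw [← this]
      exact Finset.sum_congr rfl fun k _ => by
        simp only [Matrix.of_apply, metricCoeff_comm p i k]
    simp [this]
  have expand : ∑ i, ∑ k, invMetricCoeff p i k y * weylCoeff p i j k l y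
      = ricciCoeff p j l y - 1 / ((n : ℝ) - 2) * ∑ i, ∑ k, invMetricCoeff p i k y *
          kulkarniNomizu (fun a b => ricciCoeff p a b y) (fun a b => metricCoeff p a b y) i j k l
        + scalarCurv p y / (2 * ((n : ℝ) - 1) * ((n : ℝ) - 2)) * ∑ i, ∑ k, invMetricCoeff p i k y *
          kulkarniNomizu (fun a b => metricCoeff p a b y) (fun a b => metricCoeff p a b y)
            i j k l := by
    simp only [ricciCoeff, Finset.mul_sum, ← Finset.sum_sub_distrib, ← Finset.sum_add_distrib]
    refine Finset.sum_congr rfl fun i _ => Finset.sum_congr rfl fun k _ => ?_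
    simp only [weylCoeff, ricciCoeff]
    ring
  -- The trace is `Ric - (S g + (n-2) Ric)/(n-2) + S (2n-2) g / (2(n-1)(n-2))`, in which everything
  -- cancels.
  rw [expand, key, key, hone, ← scalarCurv]
  have h1 : (n : ℝ) - 2 ≠ 0 := by linarith
  have h2 : (n : ℝ) - 1 ≠ 0 := by linarith
  field_simp
  ring

variable [IsManifold (𝓡 n) ∞ M]

/-- The differential of the inverse chart undoes `coordVec`, so each tangent vector is the
combination of the coordinate fields with its coordinates as coefficients; bilinearity does the
rest. -/
theorem sum_coordVec_mul_metricCoeff (p : M) (u v : TangentSpace (𝓡 n) p) :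
    ∑ a, ∑ b, coordVec p u a * metricCoeff p a b (chartAt (Eucl n) p p) * coordVec p v b
      = inner ℝ u v := by
  set e := chartAt (Eucl n) p
  have hp : e.symm (e p) = p := e.left_inv (mem_chart_source _ p)
  let D : Eucl n →L[ℝ] Eucl n := mfderiv 𝓘(ℝ, Eucl n) (𝓡 n) e.symm (e p)
  have hD : ∀ w : TangentSpace (𝓡 n) p, D (coordVec p w) = w := fun w => by
    have hd := (mdifferentiable_chart (I := 𝓡 n) p).symm_comp_deriv (mem_chart_source _ p)
    exact congrArg (fun L : Eucl n →L[ℝ] Eucl n => L w) hd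
  -- `metricCoeff` uses the inner product of the fibre over `e.symm (e p)`, which equals `p` only
  -- propositionally; the fibres themselves are all `Eucl n` by definition.
  have hinner : ∀ (q : M) (_ : q = p) (u w : Eucl n),
      @inner ℝ (TangentSpace (𝓡 n) q) _ u w = @inner ℝ (TangentSpace (𝓡 n) p) _ u w := by
    rintro q rfl u w; rfl
  have hm : ∀ a b, metricCoeff p a b (e p)
      = @inner ℝ (TangentSpace (𝓡 n) p) _ (D (stdVec a)) (D (stdVec b)) := fun a b =>
    hinner _ hp _ _
  have hexp : ∀ w : TangentSpace (𝓡 n) p, w = ∑ a, (coordVec p w a) •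
      (show TangentSpace (𝓡 n) p from D (stdVec a)) := fun w => by
    have h1 : coordVec p w = ∑ a, coordVec p w a • stdVec a := by
      ext i
      simp [stdVec, Pi.single_apply]
    have h2 := congrArg D h1
    rw [map_sum, hD] at h2
    simp only [map_smul] at h2
    exact h2
  conv_rhs => rw [hexp u, hexp v]
  rw [sum_inner]
  refine Finset.sum_congr rfl fun a _ => ?_
  rw [inner_sum]
  refine Finset.sum_congr rfl fun b _ => ?_
  rw [real_inner_smul_left, real_inner_smul_right, hm]
  ring

/-- Orthonormality reads `E G Eᵀ = 1` for the matrix `E` of coordinates of the frame. A one-sided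
inverse of a square matrix is two-sided, so `G Eᵀ E = 1`; this also proves that `G` is invertible.
-/
theorem frame_matrix (p : M) (ι : Eucl n ≃ₗᵢ[ℝ] TangentSpace (𝓡 n) p) :
    (Matrix.of fun a b => metricCoeff p a b (chartAt (Eucl n) p p)) *
      (Matrix.of fun a b => ∑ i, coordVec p (ι (stdVec i)) a * coordVec p (ι (stdVec i)) b) = 1 := by
  set G := Matrix.of fun a b => metricCoeff p a b (chartAt (Eucl n) p p)
  set E : Matrix (Fin n) (Fin n) ℝ := Matrix.of fun i a => coordVec p (ι (stdVec i)) a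
  have h1 : E * (G * E.transpose) = 1 := by
    ext i j
    have := sum_coordVec_mul_metricCoeff p (ι (stdVec i)) (ι (stdVec j))
    rw [ι.inner_map_map] at this
    rw [Matrix.mul_apply, Matrix.one_apply]
    simp only [Matrix.mul_apply, Finset.mul_sum]
    convert! this using 1
    · simp [E, G, mul_assoc]
    · simp [stdVec, EuclideanSpace.inner_single_left]
  have h2 := mul_eq_one_comm.mp h1
  rw [Matrix.mul_assoc] at h2
  rw [← h2]
  rfl

/-- By `frame_matrix`, summing over an orthonormal frame is contracting with the inverse metric, so
the trace-free property applies. -/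
theorem sum_weylTensor_frame (hn : 3 ≤ n) (p : M) (ι : Eucl n ≃ₗᵢ[ℝ] TangentSpace (𝓡 n) p)
    (v z : TangentSpace (𝓡 n) p) :
    ∑ i, weylTensor p (ι (stdVec i)) v (ι (stdVec i)) z = 0 := by
  have hF := frame_matrix p ι
  have hinv : ∀ a c, ∑ i, coordVec p (ι (stdVec i)) a * coordVec p (ι (stdVec i)) c
      = invMetricCoeff p a c (chartAt (Eucl n) p p) := fun a c => by
    rw [invMetricCoeff, Matrix.inv_eq_right_inv hF]; rfl
  have h0 := sum_invMetricCoeff_mul_weylCoeff hn p (chartAt (Eucl n) p p)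
    (by simp only [← hinv]; exact mul_eq_one_comm.mp hF)
  calc ∑ i, weylTensor p (ι (stdVec i)) v (ι (stdVec i)) z
      = ∑ b, ∑ d, coordVec p v b * coordVec p z d *
          ∑ a, ∑ c, invMetricCoeff p a c (chartAt (Eucl n) p p) *
            weylCoeff p a b c d (chartAt (Eucl n) p p) := by
        simp only [weylTensor, ← hinv, Finset.mul_sum, Finset.sum_mul]
        simp_rw [← Finset.sum_product']
        -- The tuple `(i, a, b, c, d)` is reordered as `(b, d, a, c, i)`.
        refine Finset.sum_bij' (fun x _ => (x.2.2.1, x.2.2.2.2, x.2.1, x.2.2.2.1, x.1))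
          (fun x _ => (x.2.2.2.2, x.2.2.1, x.1, x.2.2.2.1, x.2.1)) ?_ ?_ ?_ ?_ ?_
        · simp
        · simp
        · simp
        · simp
        · intro x _; ring
    _ = 0 := by simp [h0]

/-- The Weyl tensor contracted with `(a δᵢⱼ + b xᵢ xⱼ) x_α x_β` vanishes. -/
theorem sum_weylTensor_radial (hn : 3 ≤ n) (p : M) (ι : Eucl n ≃ₗᵢ[ℝ] TangentSpace (𝓡 n) p)
    (x : Eucl n) (a b : ℝ) :
    ∑ i, ∑ α, ∑ j, ∑ β,
      weylTensor p (ι (stdVec i)) (ι (stdVec α)) (ι (stdVec j)) (ι (stdVec β)) *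
        (x α * x β * ((if i = j then a else 0) + b * (x i * x j))) = 0 := by
  set W := fun i α j β =>
    weylTensor p (ι (stdVec i)) (ι (stdVec α)) (ι (stdVec j)) (ι (stdVec β)) with hW
  have h1 : ∑ i, ∑ α, ∑ j, ∑ β, W i α j β * (x α * x β * (if i = j then a else 0)) = 0 := by
    calc _ = ∑ i, ∑ α, ∑ β, ∑ j, W i α j β * (x α * x β * (if i = j then a else 0)) :=
          Finset.sum_congr rfl fun i _ => Finset.sum_congr rfl fun α _ => Finset.sum_comm
      _ = ∑ i, ∑ α, ∑ β, W i α i β * (x α * x β * a) := by simp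
      _ = ∑ α, ∑ β, ∑ i, W i α i β * (x α * x β * a) := by
          rw [Finset.sum_comm]
          exact Finset.sum_congr rfl fun α _ => Finset.sum_comm
      _ = 0 := by
          refine Finset.sum_eq_zero fun α _ => Finset.sum_eq_zero fun β _ => ?_
          rw [← Finset.sum_mul, sum_weylTensor_frame hn, zero_mul]
  have h2 : ∑ i, ∑ α, ∑ j, ∑ β, W i α j β * (x α * x β * (b * (x i * x j))) = 0 := by
    set S := ∑ i, ∑ α, ∑ j, ∑ β, W i α j β * (x α * x β * (b * (x i * x j))) with hS
    -- Exchanging `i` and `α` fixes the polynomial in `x` and changes the sign of the Weyl tensor.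
    have : S = -S := by
      conv_lhs => rw [hS, Finset.sum_comm]
      rw [hS]
      simp only [← Finset.sum_neg_distrib]
      refine Finset.sum_congr rfl fun i _ => Finset.sum_congr rfl fun α _ =>
        Finset.sum_congr rfl fun j _ => Finset.sum_congr rfl fun β _ => ?_
      simp only [hW]
      rw [weylTensor_swap]
      ring
    linarith
  simp only [mul_add, Finset.sum_add_distrib] at *
  rw [h1, h2, add_zero]

end Frame

/-! ## Distributional antiderivatives on the line -/

section Line

theorem exists_forall_le_abs_eq_zero {η : ℝ → ℝ} (hc : HasCompactSupport η) :
    ∃ R : ℝ, 0 < R ∧ ∀ t, R ≤ |t| → η t = 0 := by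
  obtain ⟨R, hR, h⟩ := hc.exists_pos_le_norm
  exact ⟨R, hR, fun t ht => h t (by simpa using ht)⟩

/-- The primitive that starts to the left of the support vanishes to its right exactly because the
total integral is zero. -/
theorem exists_deriv_eq_of_integral_eq_zero {η : ℝ → ℝ} (hη : ContDiff ℝ ∞ η)
    (hc : HasCompactSupport η) (h0 : ∫ t, η t = 0) :
    ∃ ψ : ℝ → ℝ, ContDiff ℝ ∞ ψ ∧ HasCompactSupport ψ ∧ deriv ψ = η := by
  obtain ⟨R, hR, hsupp⟩ := exists_forall_le_abs_eq_zero hc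
  have hcont := hη.continuous
  have hder : ∀ t, HasDerivAt (fun t => ∫ s in (-R)..t, η s) (η t) t := fun t =>
    intervalIntegral.integral_hasDerivAt_right (hcont.intervalIntegrable _ _)
      hcont.stronglyMeasurable.stronglyMeasurableAtFilter hcont.continuousAt
  have hderiv : deriv (fun t => ∫ s in (-R)..t, η s) = η := funext fun t => (hder t).deriv
  refine ⟨fun t => ∫ s in (-R)..t, η s, ?_, ?_, hderiv⟩
  · rw [contDiff_infty_iff_deriv, hderiv]
    exact ⟨fun t => (hder t).differentiableAt, hη⟩
  · refine HasCompactSupport.intro (isCompact_Icc (a := -R) (b := R)) fun t ht => ?_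
    rw [mem_Icc, not_and_or, not_le, not_le] at ht
    rcases ht with ht | ht
    · refine (intervalIntegral.integral_congr (g := fun _ => 0) fun s hs => ?_).trans (by simp)
      rw [uIcc_of_ge ht.le] at hs
      exact hsupp s (le_abs.mpr (Or.inr (by linarith [hs.2])))
    · show ∫ s in (-R)..t, η s = 0
      rw [intervalIntegral.integral_of_le (by linarith), ← h0]
      refine setIntegral_eq_integral_of_forall_compl_eq_zero fun s hs => ?_
      rw [mem_Ioc, not_and_or, not_lt, not_le] at hs
      rcases hs with hs | hs
      · exact hsupp s (le_abs.mpr (Or.inr (by linarith)))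
      · exact hsupp s (le_abs.mpr (Or.inl (by linarith)))

theorem exists_test_integral_eq_one :
    ∃ ρ : ℝ → ℝ, ContDiff ℝ ∞ ρ ∧ HasCompactSupport ρ ∧ ∫ t, ρ t = 1 := by
  let f : ContDiffBump (0 : ℝ) := ⟨1, 2, one_pos, one_lt_two⟩
  exact ⟨f.normed volume, f.contDiff_normed, f.hasCompactSupport_normed, f.integral_normed⟩

theorem integrable_mul_test {u η : ℝ → ℝ} (hu : LocallyIntegrable u)
    (hη : Continuous η) (hc : HasCompactSupport η) : Integrable fun t => u t * η t := by
  simpa [mul_comm] using hu.integrable_smul_left_of_hasCompactSupport hη hc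

/-- A pair `(u, f)` for which `∫ u η' + f η` vanishes when `η` is the derivative of a test
function satisfies `u' = f - c` for a constant `c`. -/
theorem exists_integral_mul_deriv_eq {u f : ℝ → ℝ} (hu : LocallyIntegrable u)
    (hf : LocallyIntegrable f)
    (h : ∀ ψ : ℝ → ℝ, ContDiff ℝ ∞ ψ → HasCompactSupport ψ →
      ∫ t, (u t * deriv (deriv ψ) t + f t * deriv ψ t) = 0) :
    ∃ c : ℝ, ∀ η : ℝ → ℝ, ContDiff ℝ ∞ η → HasCompactSupport η →
      ∫ t, (u t * deriv η t + (f t - c) * η t) = 0 := by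
  obtain ⟨ρ, hρ, hρc, hρ1⟩ := exists_test_integral_eq_one
  refine ⟨∫ t, (u t * deriv ρ t + f t * ρ t), fun η hη hηc => ?_⟩
  set c := ∫ t, (u t * deriv ρ t + f t * ρ t) with hc
  set m := ∫ t, η t with hm
  have hηi : Integrable η := hη.continuous.integrable_of_hasCompactSupport hηc
  have hρi : Integrable ρ := hρ.continuous.integrable_of_hasCompactSupport hρc
  -- Removing the mass of `η` with the bump `ρ` leaves a function of zero mean, hence the derivative
  -- of a test function `ψ`, for which `h` applies. The constant `c` is the value of the functional
  -- on `ρ`.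
  have hθ : ContDiff ℝ ∞ (fun t => η t - m * ρ t) := hη.sub (contDiff_const.mul hρ)
  have hθc : HasCompactSupport (fun t => η t - m * ρ t) := hηc.sub hρc.mul_left
  obtain ⟨ψ, hψ, hψc, hψd⟩ := exists_deriv_eq_of_integral_eq_zero hθ hθc (by
    rw [integral_sub hηi (hρi.const_mul m), integral_const_mul, hρ1, ← hm]; ring)
  have key := h ψ hψ hψc
  have hdη : ∀ t, HasDerivAt η (deriv η t) t := fun t =>
    (hη.differentiable (by simp) t).hasDerivAt
  have hdρ : ∀ t, HasDerivAt ρ (deriv ρ t) t := fun t =>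
    (hρ.differentiable (by simp) t).hasDerivAt
  have hdθ : deriv (deriv ψ) = fun t => deriv η t - m * deriv ρ t := by
    rw [hψd]; funext t; exact ((hdη t).sub ((hdρ t).const_mul m)).deriv
  rw [hdθ, hψd] at key
  have i1 : Integrable fun t => u t * deriv η t :=
    integrable_mul_test hu (hη.continuous_deriv (by simp)) hηc.deriv
  have i2 : Integrable fun t => f t * η t :=
    integrable_mul_test hf hη.continuous hηc
  have i3 : Integrable fun t => u t * deriv ρ t :=
    integrable_mul_test hu (hρ.continuous_deriv (by simp)) hρc.deriv
  have i4 : Integrable fun t => f t * ρ t :=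
    integrable_mul_test hf hρ.continuous hρc
  have j1 : Integrable fun t => u t * deriv η t + f t * η t := i1.add i2
  have j2 : Integrable fun t => u t * deriv ρ t + f t * ρ t := i3.add i4
  have e1 : ∀ t, u t * (deriv η t - m * deriv ρ t) + f t * (η t - m * ρ t)
      = (u t * deriv η t + f t * η t) - m * (u t * deriv ρ t + f t * ρ t) := fun t => by ring
  have e2 : ∀ t, u t * deriv η t + (f t - c) * η t
      = (u t * deriv η t + f t * η t) - c * η t := fun t => by ring
  simp only [e1] at key
  rw [integral_sub j1 (j2.const_mul m), integral_const_mul, ← hc] at key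
  simp only [e2]
  rw [integral_sub j1 (hηi.const_mul c), integral_const_mul, ← hm]
  linarith

theorem ae_eq_const_of_integral_mul_deriv {u : ℝ → ℝ} (hu : LocallyIntegrable u)
    (h : ∀ ψ : ℝ → ℝ, ContDiff ℝ ∞ ψ → HasCompactSupport ψ → ∫ t, u t * deriv ψ t = 0) :
    ∃ c : ℝ, ∀ᵐ t, u t = c := by
  obtain ⟨c, hc⟩ := exists_integral_mul_deriv_eq (u := fun _ => 0) (f := u)
    (locallyIntegrable_const 0) hu fun ψ hψ hψc => by simpa using h ψ hψ hψc
  refine ⟨c, ?_⟩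
  have h0 := ae_eq_zero_of_integral_contDiff_smul_eq_zero (f := fun t => u t - c)
    (hu.sub (locallyIntegrable_const c)) fun g hg hgc => by
      simpa [mul_comm] using hc g hg hgc
  filter_upwards [h0] with t ht
  linarith

theorem intervalIntegrable_of_locallyIntegrable {f : ℝ → ℝ} (hf : LocallyIntegrable f) (a b : ℝ) :
    IntervalIntegrable f volume a b :=
  (hf.integrableOn_isCompact isCompact_uIcc).intervalIntegrable

theorem continuous_integral_of_locallyIntegrable {f : ℝ → ℝ} (hf : LocallyIntegrable f) :
    Continuous fun t => ∫ s in (0 : ℝ)..t, f s :=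
  intervalIntegral.continuous_primitive (intervalIntegrable_of_locallyIntegrable hf) 0

/-- As `f` is only locally integrable, its primitive is merely absolutely continuous with derivative
`f` almost everywhere; this suffices for integration by parts. -/
theorem integral_primitive_mul_deriv {f ψ : ℝ → ℝ} (hf : LocallyIntegrable f)
    (hψ : ContDiff ℝ ∞ ψ) (hc : HasCompactSupport ψ) :
    ∫ t, (∫ s in (0 : ℝ)..t, f s) * deriv ψ t = -∫ t, f t * ψ t := by
  obtain ⟨R, hR, hsupp⟩ := exists_forall_le_abs_eq_zero hc
  obtain ⟨R', hR', hsupp'⟩ := exists_forall_le_abs_eq_zero hc.deriv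
  -- `[-A, A]` contains the supports of `ψ` and of its derivative, so the boundary terms vanish and
  -- the integrals extend to the line.
  set A := max R R'
  have hA : -A ≤ A := by linarith [le_max_left R R']
  have huIcc : (0 : ℝ) ∈ uIcc (-A) A := by
    rw [uIcc_of_le hA]; constructor <;> linarith [le_max_left R R']
  have hint : IntervalIntegrable f volume (-A) A := intervalIntegrable_of_locallyIntegrable hf _ _
  have hF := hint.absolutelyContinuousOnInterval_intervalIntegral huIcc
  have hψ1 : ContDiff ℝ 1 ψ := hψ.of_le (by simp)
  have hψA : AbsolutelyContinuousOnInterval ψ (-A) A := by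
    obtain ⟨K, hK⟩ := hψ1.lipschitzWith_of_hasCompactSupport hc (by simp)
    exact (hK.lipschitzOnWith (s := uIcc (-A) A)).absolutelyContinuousOnInterval
  have hparts := hF.integral_mul_deriv_eq_deriv_mul hψA
  have toLine : ∀ g : ℝ → ℝ, (∀ t, A ≤ |t| → g t = 0) →
      ∫ t in (-A)..A, g t = ∫ t, g t := fun g hg => by
    rw [intervalIntegral.integral_of_le hA]
    refine setIntegral_eq_integral_of_forall_compl_eq_zero fun s hs => ?_
    rw [mem_Ioc, not_and_or, not_lt, not_le] at hs
    rcases hs with hs | hs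
    · exact hg s (le_abs.mpr (Or.inr (by linarith)))
    · exact hg s (le_abs.mpr (Or.inl (by linarith)))
  have hAabs : |A| = A := abs_of_nonneg (by linarith [le_max_left R R'])
  rw [toLine _ fun t ht => by rw [hsupp' t ((le_max_right _ _).trans ht), mul_zero],
    hsupp A (by rw [hAabs]; exact le_max_left _ _),
    hsupp (-A) (by rw [abs_neg, hAabs]; exact le_max_left _ _)] at hparts
  rw [hparts, ← toLine (fun t => f t * ψ t) fun t ht => by
    rw [hsupp t ((le_max_left _ _).trans ht), mul_zero]]
  have hae : ∫ t in (-A)..A, deriv (fun x => ∫ s in (0 : ℝ)..x, f s) t * ψ t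
      = ∫ t in (-A)..A, f t * ψ t := by
    refine intervalIntegral.integral_congr_ae ?_
    filter_upwards [hint.ae_hasDerivAt_integral] with t ht hmem
    rw [(ht (uIoc_subset_uIcc hmem) 0 huIcc).deriv]
  rw [hae]
  ring

/-- A function whose second distributional derivative is the locally integrable function `f` is
almost everywhere a second antiderivative of `f`. -/
theorem ae_eq_of_integral_mul_deriv_deriv {w f : ℝ → ℝ} (hw : LocallyIntegrable w)
    (hf : LocallyIntegrable f)
    (h : ∀ ψ : ℝ → ℝ, ContDiff ℝ ∞ ψ → HasCompactSupport ψ →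
      ∫ t, w t * deriv (deriv ψ) t = ∫ t, f t * ψ t) :
    ∃ a b : ℝ, ∀ᵐ t, w t = a + ∫ s in (0 : ℝ)..t, (b + ∫ r in (0 : ℝ)..s, f r) := by
  set F := fun t => ∫ s in (0 : ℝ)..t, f s
  have hFc : Continuous F := continuous_integral_of_locallyIntegrable hf
  have hFl : LocallyIntegrable F := hFc.locallyIntegrable
  -- Since `F' = f`, this gives `w' = F - c`. The difference between `w` and a primitive of `F - c`
  -- is then constant.
  obtain ⟨c, hc⟩ := exists_integral_mul_deriv_eq hw hFl fun ψ hψ hψc => by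
    have hψ' : ContDiff ℝ ∞ (deriv ψ) := (contDiff_infty_iff_deriv.mp hψ).2
    rw [integral_add (integrable_mul_test hw (hψ'.continuous_deriv (by simp))
      hψc.deriv.deriv) (integrable_mul_test hFl hψ'.continuous hψc.deriv),
      h ψ hψ hψc, integral_primitive_mul_deriv hf hψ hψc]
    ring
  have hgc : Continuous fun t => -c + F t := continuous_const.add hFc
  have hgl : LocallyIntegrable fun t => -c + F t := hgc.locallyIntegrable
  have hGl : LocallyIntegrable fun t => ∫ s in (0 : ℝ)..t, (-c + F s) :=
    (continuous_integral_of_locallyIntegrable hgl).locallyIntegrable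
  obtain ⟨a, ha⟩ := ae_eq_const_of_integral_mul_deriv (hw.sub hGl) fun η hη hηc => by
    have hdc := hη.continuous_deriv (by simp)
    have i1 := integrable_mul_test hw hdc hηc.deriv
    have i2 := integrable_mul_test hGl hdc hηc.deriv
    have i3 := integrable_mul_test hgl hη.continuous hηc
    have e : ∀ t, (F t - c) * η t = (-c + F t) * η t := fun t => by ring
    have key := hc η hη hηc
    simp only [e] at key
    rw [integral_add i1 i3] at key
    simp only [Pi.sub_apply, sub_mul]
    rw [integral_sub i1 i2, integral_primitive_mul_deriv hgl hη hηc]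
    linarith
  refine ⟨a, -c, ?_⟩
  filter_upwards [ha] with t ht
  rw [Pi.sub_apply] at ht
  linarith

end Line

/-! ## The equation `w'' = γ² w - |w|^{2/γ} w` on the line -/

section EmdenFowler

theorem eq_const_of_hasDerivAt_zero {f : ℝ → ℝ} (h : ∀ t, HasDerivAt f 0 t) (t s : ℝ) :
    f t = f s :=
  is_const_of_deriv_eq_zero (fun t => (h t).differentiableAt) (fun t => (h t).deriv) t s

theorem abs_rpow_eq_mul_sq {p : ℝ} (hp : 2 < p) (x : ℝ) : |x| ^ p = |x| ^ (p - 2) * x ^ 2 := by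
  rcases eq_or_ne x 0 with rfl | hx
  · simp [Real.zero_rpow (by linarith : p ≠ 0)]
  · have : 0 < |x| := abs_pos.mpr hx
    rw [← sq_abs x, ← Real.rpow_natCast, ← Real.rpow_add this]
    norm_num

/-- The first integral obtained by multiplying the equation by `w'`. -/
theorem energy_const {γ p : ℝ} (hp : 2 < p) {w z : ℝ → ℝ} (hw : ∀ t, HasDerivAt w (z t) t)
    (hz : ∀ t, HasDerivAt z (γ ^ 2 * w t - |w t| ^ (p - 2) * w t) t) :
    ∃ E : ℝ, ∀ t, z t ^ 2 / 2 - γ ^ 2 * w t ^ 2 / 2 + |w t| ^ p / p = E := by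
  refine ⟨_, fun t => eq_const_of_hasDerivAt_zero (f := fun t =>
    z t ^ 2 / 2 - γ ^ 2 * w t ^ 2 / 2 + |w t| ^ p / p) (fun t => ?_) t 0⟩
  have h1 := (((hz t).pow 2).div_const 2)
  have h2 := ((((hw t).pow 2).const_mul (γ ^ 2)).div_const 2)
  have h3 := (((hasDerivAt_abs_rpow (w t) (by linarith : 1 < p)).comp t (hw t)).div_const p)
  convert! (h1.sub h2).add h3 using 1
  have : p ≠ 0 := by linarith
  field_simp
  ring

/-- The sublevel sets of the energy are bounded, since `|w|^p` beats `w²` for `p > 2`. -/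
theorem bounded_of_energy {γ p E : ℝ} (hp : 2 < p) {w z : ℝ → ℝ}
    (hE : ∀ t, z t ^ 2 / 2 - γ ^ 2 * w t ^ 2 / 2 + |w t| ^ p / p = E) :
    ∃ K : ℝ, 0 < K ∧ (∀ t, |w t| ≤ K) ∧ ∀ t, |z t| ≤ K := by
  have hp0 : 0 < p := by linarith
  -- Beyond this threshold `|w|^p/p ≥ (γ² + 2|E| + 1) w²`, too much for the energy to be `E` once
  -- `|w| ≥ 1`.
  obtain ⟨K, hK⟩ := eventually_atTop.mp
    ((tendsto_rpow_atTop (by linarith : 0 < p - 2)).eventually_ge_atTop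
      (p * (γ ^ 2 + 2 * |E| + 1)))
  set L := max K 1
  have hL : 1 ≤ L := le_max_right _ _
  have hwL : ∀ t, |w t| ≤ L := fun t => by
    by_contra! hlt
    have h1 := hK _ ((le_max_left _ _).trans hlt.le)
    have h2 : 1 ≤ w t ^ 2 := by
      rw [← sq_abs]; nlinarith [abs_nonneg (w t)]
    have h3 : (γ ^ 2 + 2 * |E| + 1) * w t ^ 2 ≤ |w t| ^ p / p := by
      rw [abs_rpow_eq_mul_sq hp, le_div_iff₀ hp0]
      nlinarith [mul_le_mul_of_nonneg_right h1 (sq_nonneg (w t))]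
    have h4 := hE t
    have h5 : (2 * |E| + 1) * 1 ≤ (2 * |E| + 1) * w t ^ 2 :=
      mul_le_mul_of_nonneg_left h2 (by positivity)
    nlinarith [le_abs_self E, abs_nonneg E, sq_nonneg (z t), mul_nonneg (sq_nonneg γ)
      (sq_nonneg (w t))]
  set N := 2 * |E| + γ ^ 2 * L ^ 2 + 1
  have hzN : ∀ t, |z t| ≤ N := fun t => by
    have h1 : z t ^ 2 ≤ N := by
      have h2 := hE t
      have h3 : 0 ≤ |w t| ^ p / p := by positivity
      have h4 : w t ^ 2 ≤ L ^ 2 := by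
        rw [← sq_abs]; exact pow_le_pow_left₀ (abs_nonneg _) (hwL t) 2
      have h5 := mul_le_mul_of_nonneg_left h4 (sq_nonneg γ)
      simp only [N]
      linarith [le_abs_self E]
    have hN1 : 1 ≤ N := by simp only [N]; nlinarith [abs_nonneg E, sq_nonneg (γ * L)]
    apply abs_le_of_sq_le_sq (h1.trans (by nlinarith)) (by linarith)
  refine ⟨max L N, lt_max_of_lt_left (by linarith), fun t => (hwL t).trans (le_max_left _ _),
    fun t => (hzN t).trans (le_max_right _ _)⟩

/-- A function that is integrable together with its derivative tends to zero. The power `p + 1` is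
used instead of `p` because its derivative has size at most `(p+1) K |w|^p`, which is integrable. -/
theorem tendsto_zero_of_integrable_abs_rpow {p K : ℝ} (hp : 2 < p) {w z : ℝ → ℝ}
    (hw : ∀ t, HasDerivAt w (z t) t) (hzc : Continuous z) (hwK : ∀ t, |w t| ≤ K)
    (hzK : ∀ t, |z t| ≤ K) (hint : Integrable fun t => |w t| ^ p) :
    Tendsto w atTop (𝓝 0) := by
  have hwc : Continuous w := continuous_iff_continuousAt.mpr fun t => (hw t).continuousAt
  have hder : ∀ t, HasDerivAt (fun t => |w t| ^ (p + 1))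
      ((p + 1) * |w t| ^ (p + 1 - 2) * w t * z t) t := fun t =>
    (hasDerivAt_abs_rpow (w t) (by linarith : 1 < p + 1)).comp t (hw t)
  have habs : ∀ q : ℝ, 0 ≤ q → ∀ t, |w t| ^ (q + 1) = |w t| ^ q * |w t| := fun q hq t => by
    rw [Real.rpow_add_of_nonneg (abs_nonneg _) hq zero_le_one, Real.rpow_one]
  have hcr : ∀ q : ℝ, 0 ≤ q → Continuous fun t => |w t| ^ q := fun q hq =>
    hwc.abs.rpow_const fun t => Or.inr hq
  have i1 : Integrable fun t => |w t| ^ (p + 1) := by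
    refine (hint.const_mul K).mono' (hcr _ (by linarith)).aestronglyMeasurable
      (ae_of_all _ fun t => ?_)
    rw [Real.norm_of_nonneg (by positivity), habs p (by linarith), mul_comm]
    exact mul_le_mul_of_nonneg_right (hwK t) (by positivity)
  have i2 : Integrable fun t => (p + 1) * |w t| ^ (p + 1 - 2) * w t * z t := by
    refine (hint.const_mul ((p + 1) * K)).mono'
      (((continuous_const.mul (hcr _ (by linarith))).mul hwc).mul hzc).aestronglyMeasurable
      (ae_of_all _ fun t => ?_)
    have e : |w t| ^ p = |w t| ^ (p + 1 - 2) * |w t| := by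
      rw [← habs _ (by linarith)]; ring_nf
    rw [Real.norm_eq_abs, abs_mul, abs_mul, abs_mul, abs_of_pos (by linarith : 0 < p + 1),
      abs_of_nonneg (by positivity : 0 ≤ |w t| ^ (p + 1 - 2)), e]
    calc (p + 1) * |w t| ^ (p + 1 - 2) * |w t| * |z t|
        ≤ (p + 1) * |w t| ^ (p + 1 - 2) * |w t| * K :=
          mul_le_mul_of_nonneg_left (hzK t) (by positivity)
      _ = (p + 1) * K * (|w t| ^ (p + 1 - 2) * |w t|) := by ring
  have h0 := tendsto_zero_of_hasDerivAt_of_integrableOn_Ioi (a := 0) (fun t _ => hder t)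
    i2.integrableOn i1.integrableOn
  have h1 := h0.rpow_const (p := (p + 1)⁻¹) (Or.inr (by positivity))
  rw [Real.zero_rpow (by positivity)] at h1
  rw [tendsto_zero_iff_abs_tendsto_zero]
  refine h1.congr fun t => ?_
  rw [← Real.rpow_mul (abs_nonneg _), mul_inv_cancel₀ (by linarith), Real.rpow_one]
  rfl

/-- As `w → 0` at `+∞` with `w'` bounded, `w w' → 0`, whereas `(w w')' = w'² + w w''` tends to `2E`.
The mean value theorem on `[t, t+1]` makes the two compatible only if `E = 0`. -/
theorem energy_eq_zero {γ p E : ℝ} (hp : 2 < p) {w z : ℝ → ℝ}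
    (hw : ∀ t, HasDerivAt w (z t) t)
    (hz : ∀ t, HasDerivAt z (γ ^ 2 * w t - |w t| ^ (p - 2) * w t) t)
    (hint : Integrable fun t => |w t| ^ p)
    (hE : ∀ t, z t ^ 2 / 2 - γ ^ 2 * w t ^ 2 / 2 + |w t| ^ p / p = E) : E = 0 := by
  obtain ⟨K, hK, hwK, hzK⟩ := bounded_of_energy hp hE
  have hzc : Continuous z := continuous_iff_continuousAt.mpr fun t => (hz t).continuousAt
  have hw0 := tendsto_zero_of_integrable_abs_rpow hp hw hzc hwK hzK hint
  have hp0 : Tendsto (fun t => |w t| ^ p) atTop (𝓝 0) := by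
    have := (tendsto_zero_iff_abs_tendsto_zero _ |>.mp hw0).rpow_const (p := p)
      (Or.inr (by linarith))
    rwa [Real.zero_rpow (by linarith)] at this
  have hwz : Tendsto (fun t => w t * z t) atTop (𝓝 0) := by
    refine squeeze_zero_norm (fun t => ?_)
      (by simpa using (tendsto_zero_iff_abs_tendsto_zero _ |>.mp hw0).mul_const K)
    rw [Real.norm_eq_abs, abs_mul]
    exact mul_le_mul_of_nonneg_left (hzK t) (abs_nonneg _)
  have hder : ∀ t, HasDerivAt (fun t => w t * z t)
      (z t * z t + w t * (γ ^ 2 * w t - |w t| ^ (p - 2) * w t)) t := fun t => (hw t).mul (hz t)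
  have hlim : Tendsto (fun t => z t * z t + w t * (γ ^ 2 * w t - |w t| ^ (p - 2) * w t)) atTop
      (𝓝 (2 * E)) := by
    have e : ∀ t, z t * z t + w t * (γ ^ 2 * w t - |w t| ^ (p - 2) * w t)
        = 2 * E + 2 * γ ^ 2 * w t ^ 2 - (2 / p + 1) * |w t| ^ p := fun t => by
      have h1 := hE t
      have h2 := abs_rpow_eq_mul_sq hp (w t)
      have h3 : z t ^ 2 = 2 * E + γ ^ 2 * w t ^ 2 - 2 * (|w t| ^ p / p) := by linarith
      have h4 : z t * z t + w t * (γ ^ 2 * w t - |w t| ^ (p - 2) * w t)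
        = z t ^ 2 + γ ^ 2 * w t ^ 2 - |w t| ^ (p - 2) * w t ^ 2 := by ring
      rw [h4, h3, ← h2]
      ring
    simp only [e]
    have := ((hw0.pow 2).const_mul (2 * γ ^ 2)).const_add (2 * E) |>.sub
      (hp0.const_mul (2 / p + 1))
    simpa using this
  have hmvt : ∀ t : ℝ, ∃ ξ, t < ξ ∧ z ξ * z ξ + w ξ * (γ ^ 2 * w ξ - |w ξ| ^ (p - 2) * w ξ)
      = w (t + 1) * z (t + 1) - w t * z t := fun t => by
    obtain ⟨ξ, hξ, he⟩ := exists_hasDerivAt_eq_slope _ _ (by linarith : t < t + 1)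
      (fun s _ => (hder s).continuousAt.continuousWithinAt) fun s _ => hder s
    exact ⟨ξ, hξ.1, by rw [he]; simp⟩
  choose ξ hξ he using hmvt
  have hξt : Tendsto ξ atTop atTop := tendsto_atTop_mono (fun t => (hξ t).le) tendsto_id
  have l1 := hlim.comp hξt
  have l2 : Tendsto (fun t => w (t + 1) * z (t + 1) - w t * z t) atTop (𝓝 0) := by
    simpa using (hwz.comp (tendsto_atTop_add_const_right atTop (1 : ℝ) tendsto_id)).sub hwz
  have := tendsto_nhds_unique (l1.congr fun t => he t) l2
  linarith

/-- Grönwall in both directions: `w² e^{-2γt}` is nonincreasing and `w² e^{2γt}` nondecreasing, so a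
zero propagates forwards and backwards. -/
theorem eq_zero_of_abs_deriv_le {γ : ℝ} {w z : ℝ → ℝ} (hγ : 0 ≤ γ)
    (hw : ∀ t, HasDerivAt w (z t) t)
    (hzw : ∀ t, z t ^ 2 ≤ γ ^ 2 * w t ^ 2) {t₀ : ℝ} (h0 : w t₀ = 0) (t : ℝ) : w t = 0 := by
  have hwz : ∀ t, |w t * z t| ≤ γ * w t ^ 2 := fun t => by
    refine abs_le_of_sq_le_sq ?_ (by positivity)
    nlinarith [mul_le_mul_of_nonneg_left (hzw t) (sq_nonneg (w t))]
  have hder : ∀ c t : ℝ, HasDerivAt (fun t => w t ^ 2 * Real.exp (c * t))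
      ((2 * (w t * z t) + c * w t ^ 2) * Real.exp (c * t)) t := fun c t => by
    have h1 := ((hw t).pow 2).mul (((hasDerivAt_id t).const_mul c).exp)
    convert! h1 using 1
    simp
    ring
  have hcl : ∀ c : ℝ, w t ^ 2 * Real.exp (c * t) ≤ w t₀ ^ 2 * Real.exp (c * t₀) → w t = 0 :=
    fun c hle => by
      rw [h0] at hle
      have := Real.exp_pos (c * t)
      have h2 : w t ^ 2 ≤ 0 := by
        by_contra! h3
        nlinarith [mul_pos h3 this]
      exact pow_eq_zero_iff two_ne_zero |>.mp (le_antisymm h2 (sq_nonneg _))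
  rcases le_total t₀ t with h | h
  · refine hcl (-2 * γ) ?_
    refine antitone_of_hasDerivAt_nonpos (hder (-2 * γ)) (fun s => ?_) h
    refine mul_nonpos_of_nonpos_of_nonneg ?_ (Real.exp_pos _).le
    have := (abs_le.mp (hwz s)).2
    linarith
  · refine hcl (2 * γ) ?_
    refine monotone_of_hasDerivAt_nonneg (hder (2 * γ)) (fun s => ?_) h
    refine mul_nonneg ?_ (Real.exp_pos _).le
    have := (abs_le.mp (hwz s)).1
    linarith

theorem eq_of_pos_of_energy {γ : ℝ} (hγ : 0 < γ) {w z : ℝ → ℝ} (hpos : ∀ t, 0 < w t)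
    (hw : ∀ t, HasDerivAt w (z t) t)
    (hz : ∀ t, HasDerivAt z (γ ^ 2 * w t - w t ^ (2 / γ) * w t) t)
    (hE : ∀ t, z t ^ 2 = γ ^ 2 * w t ^ 2 - γ / (γ + 1) * (w t ^ (2 / γ) * w t ^ 2)) :
    ∃ a b : ℝ, 0 < a ∧ 0 < b ∧ a * b = 1 / (4 * γ * (γ + 1)) ∧
      ∀ t, w t = (a * Real.exp t + b * Real.exp (-t)) ^ (-γ) := by
  set u := fun t => w t ^ (-(1 / γ)) with hu
  set y := fun t => -(1 / γ) * (u t / w t) * z t with hy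
  have hupos : ∀ t, 0 < u t := fun t => Real.rpow_pos_of_pos (hpos t) _
  have hu1 : ∀ t, HasDerivAt u (y t) t := fun t => by
    have := (hw t).rpow_const (p := -(1 / γ)) (Or.inl (hpos t).ne')
    convert! this using 1
    simp only [hy, hu]
    rw [Real.rpow_sub_one (hpos t).ne']
    ring
  have hQ : ∀ t, u t ^ 2 * w t ^ (2 / γ) = 1 := fun t => by
    rw [hu, ← Real.rpow_natCast, ← Real.rpow_mul (hpos t).le, ← Real.rpow_add (hpos t)]
    rw [show -(1 / γ) * ((2 : ℕ) : ℝ) + 2 / γ = 0 by push_cast; ring, Real.rpow_zero]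
  have hy1 : ∀ t, HasDerivAt y (u t) t := fun t => by
    have hd := ((((hu1 t).div (hw t) (hpos t).ne').const_mul (-(1 / γ))).mul (hz t))
    convert! hd using 1
    have hne := (hpos t).ne'
    have h1 := hE t
    simp only [hy]
    generalize w t ^ (2 / γ) = Q at *
    have e : (-(1 / γ) * ((-(1 / γ) * (u t / w t) * z t * w t - u t * z t) / w t ^ 2) * z t +
        -(1 / γ) * (u t / w t) * (γ ^ 2 * w t - Q * w t))
        = u t * ((1 / γ) * (1 / γ + 1) * (z t ^ 2 / w t ^ 2) - (1 / γ) * (γ ^ 2 - Q)) := by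
      field_simp
      ring
    rw [Pi.div_apply, e, h1]
    field_simp
    ring
  -- For `u = a e^t + b e^{-t}` the quantity `u² - u'²` is `4ab`; this is what fixes the product
  -- `ab`.
  have hrel : ∀ t, u t ^ 2 - y t ^ 2 = 1 / (γ * (γ + 1)) := fun t => by
    have hne := (hpos t).ne'
    have e : y t ^ 2 = (1 / γ) ^ 2 * u t ^ 2 / w t ^ 2 * z t ^ 2 := by
      simp only [hy]; ring
    have h2 : u t ^ 2 - (1 / γ) ^ 2 * u t ^ 2 / w t ^ 2 * (γ ^ 2 * w t ^ 2
        - γ / (γ + 1) * (w t ^ (2 / γ) * w t ^ 2))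
        = 1 / (γ * (γ + 1)) * (u t ^ 2 * w t ^ (2 / γ)) := by
      field_simp
      ring
    rw [e, hE, h2, hQ, mul_one]
  have hexp : ∀ c t : ℝ, HasDerivAt (fun t => Real.exp (c * t)) (c * Real.exp (c * t)) t :=
    fun c t => by
      have := ((hasDerivAt_id t).const_mul c).exp
      convert! this using 1
      simp; ring
  -- For `c = ±1` the combinations `(u + c u') e^{-ct}` are constant, and they yield `2a` and `2b`.
  have hconst : ∀ c : ℝ, c ^ 2 = 1 → ∀ t, (u t + c * y t) * Real.exp (-c * t) = u 0 + c * y 0 :=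
    fun c hc t => by
      have hd : ∀ t, HasDerivAt (fun t => (u t + c * y t) * Real.exp (-c * t)) 0 t := fun t => by
        have := ((hu1 t).add ((hy1 t).const_mul c)).mul (hexp (-c) t)
        convert! this using 1
        simp only [Pi.add_apply]
        linear_combination (y t * Real.exp (-c * t)) * hc
      have := eq_const_of_hasDerivAt_zero hd t 0
      simpa using this
  have hplus := hconst 1 (by norm_num)
  have hminus := hconst (-1) (by norm_num)
  have hab : (u 0 + 1 * y 0) / 2 * ((u 0 + -1 * y 0) / 2) = 1 / (4 * γ * (γ + 1)) := by
    have := hrel 0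
    have e : 1 / (4 * γ * (γ + 1)) = 1 / (γ * (γ + 1)) / 4 := by field_simp
    rw [e, ← this]; ring
  have hab0 : 0 < (u 0 + 1 * y 0) / 2 * ((u 0 + -1 * y 0) / 2) := by
    rw [hab]; positivity
  have hsum : 0 < (u 0 + 1 * y 0) / 2 + (u 0 + -1 * y 0) / 2 := by
    have := hupos 0
    linarith
  -- `ab > 0` gives `a` and `b` the same sign, and `a + b = u 0 > 0` decides which.
  have hapos : 0 < (u 0 + 1 * y 0) / 2 := by
    rcases pos_and_pos_or_neg_and_neg_of_mul_pos hab0 with h | h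
    · exact h.1
    · linarith [h.1, h.2]
  refine ⟨_, _, hapos, (pos_iff_pos_of_mul_pos hab0).mp hapos, hab, fun t => ?_⟩
  have e1 : u t + 1 * y t = (u 0 + 1 * y 0) * Real.exp t := by
    rw [← hplus t, mul_assoc, ← Real.exp_add]; simp
  have e2 : u t + -1 * y t = (u 0 + -1 * y 0) * Real.exp (-t) := by
    rw [← hminus t, mul_assoc, ← Real.exp_add]; simp
  have e3 : (u 0 + 1 * y 0) / 2 * Real.exp t + (u 0 + -1 * y 0) / 2 * Real.exp (-t) = u t := by
    linarith
  rw [e3, hu, ← Real.rpow_mul (hpos t).le]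
  rw [show -(1 / γ) * -γ = 1 by field_simp, Real.rpow_one]

/-- The non-zero solutions of `w'' = γ² w - |w|^{p-2} w`, `p = 2 + 2/γ`, that belong to
`L^p(ℝ)`. -/
theorem eq_of_integrable_abs_rpow {γ p : ℝ} (hγ : 0 < γ) (hpγ : p = 2 + 2 / γ) {w z : ℝ → ℝ}
    (hw : ∀ t, HasDerivAt w (z t) t)
    (hz : ∀ t, HasDerivAt z (γ ^ 2 * w t - |w t| ^ (p - 2) * w t) t)
    (hint : Integrable fun t => |w t| ^ p) (hne : ∃ t, w t ≠ 0) :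
    ∃ σ : ℝ, (σ = 1 ∨ σ = -1) ∧ ∃ a b : ℝ, 0 < a ∧ 0 < b ∧ a * b = 1 / (4 * γ * (γ + 1)) ∧
      ∀ t, w t = σ * (a * Real.exp t + b * Real.exp (-t)) ^ (-γ) := by
  have hp : 2 < p := by rw [hpγ]; linarith [div_pos two_pos hγ]
  have hp2 : p - 2 = 2 / γ := by rw [hpγ]; ring
  obtain ⟨E, hE⟩ := energy_const hp hw hz
  obtain rfl := energy_eq_zero hp hw hz hint hE
  have hE' : ∀ t, z t ^ 2 = γ ^ 2 * w t ^ 2 - γ / (γ + 1) * (|w t| ^ (2 / γ) * w t ^ 2) :=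
    fun t => by
      have h1 := hE t
      rw [abs_rpow_eq_mul_sq hp, hp2] at h1
      have h2 : γ / (γ + 1) = 2 / p := by rw [hpγ]; field_simp
      rw [h2]
      linear_combination 2 * h1
  have hle : ∀ t, z t ^ 2 ≤ γ ^ 2 * w t ^ 2 := fun t => by
    rw [hE']
    have : 0 ≤ γ / (γ + 1) * (|w t| ^ (2 / γ) * w t ^ 2) := by positivity
    linarith
  have hw0 : ∀ t, w t ≠ 0 := fun t h0 => by
    obtain ⟨s, hs⟩ := hne
    exact hs (eq_zero_of_abs_deriv_le hγ.le hw hle h0 s)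
  have hwc : Continuous w := continuous_iff_continuousAt.mpr fun t => (hw t).continuousAt
  rw [hp2] at hz
  have hsign : (∀ t, 0 < w t) ∨ ∀ t, w t < 0 := by
    by_contra! hcon
    obtain ⟨⟨t, ht⟩, s, hs⟩ := hcon
    obtain ⟨r, hr⟩ := mem_range_of_exists_le_of_exists_ge hwc ⟨t, ht⟩ ⟨s, hs⟩
    exact hw0 r hr
  rcases hsign with hpos | hneg
  · obtain ⟨a, b, ha, hb, hab, h⟩ := eq_of_pos_of_energy hγ hpos hw
      (fun t => by simpa only [abs_of_pos (hpos t)] using hz t)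
      (fun t => by simpa only [abs_of_pos (hpos t)] using hE' t)
    exact ⟨1, Or.inl rfl, a, b, ha, hb, hab, fun t => by rw [one_mul]; exact h t⟩
  · obtain ⟨a, b, ha, hb, hab, h⟩ := eq_of_pos_of_energy (w := fun t => -w t)
      (z := fun t => -z t) hγ (fun t => neg_pos.mpr (hneg t)) (fun t => (hw t).neg)
      (fun t => by
        have := (hz t).neg
        rw [abs_of_neg (hneg t)] at this
        convert! this using 1
        ring)
      (fun t => by
        have := hE' t
        rw [abs_of_neg (hneg t)] at this
        simpa using this)
    exact ⟨-1, Or.inr rfl, a, b, ha, hb, hab, fun t => by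
      have := h t
      linarith⟩

end EmdenFowler

/-! ## The distributional form of the equation -/

section Distribution

/-- Hölder's inequality with the conjugate exponent `q = (1 - p⁻¹)⁻¹`. The vector-valued form serves
both the gradients in `L²` and the functions in `L^{2*}`. -/
theorem tendsto_integral_inner {X E : Type*} [MeasurableSpace X] {ν : Measure X}
    [NormedAddCommGroup E] [InnerProductSpace ℝ E] {p : ℝ≥0∞} (hp : 1 ≤ p)
    {f : ℕ → X → E} {f₀ g : X → E} (hf : ∀ k, MemLp (f k) p ν) (hf₀ : MemLp f₀ p ν)
    (hg : ∀ q, MemLp g q ν)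
    (hlim : Tendsto (fun k => eLpNorm (f k - f₀) p ν) atTop (𝓝 0)) :
    Tendsto (fun k => ∫ x, inner ℝ (f k x) (g x) ∂ν) atTop (𝓝 (∫ x, inner ℝ (f₀ x) (g x) ∂ν)) := by
  have : ENNReal.HolderTriple p (1 - p⁻¹)⁻¹ 1 :=
    ⟨by rw [inv_inv, inv_one, add_tsub_cancel_of_le (ENNReal.inv_le_one.mpr hp)]⟩
  set q := (1 - p⁻¹)⁻¹
  have holder : ∀ h : X → E, AEStronglyMeasurable h ν →
      eLpNorm (fun x => inner ℝ (h x) (g x)) 1 ν ≤ eLpNorm h p ν * eLpNorm g q ν := fun h hh => by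
    have := eLpNorm_le_eLpNorm_mul_eLpNorm_of_nnnorm (p := p) (q := q) (r := 1) hh (hg q).1
      (fun a b => inner ℝ a b) 1 (ae_of_all _ fun x => by
        rw [one_mul]; exact nnnorm_inner_le_nnnorm _ _)
    simpa using this
  have hint : ∀ h : X → E, MemLp h p ν → Integrable (fun x => inner ℝ (h x) (g x)) ν :=
    fun h hh => memLp_one_iff_integrable.mp ⟨hh.1.inner (hg q).1,
      (holder h hh.1).trans_lt (ENNReal.mul_lt_top hh.2 (hg q).2)⟩
  refine tendsto_integral_of_L1' _ (hint f₀ hf₀).1 (Eventually.of_forall fun k => hint _ (hf k)) ?_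
  have hz : Tendsto (fun k => eLpNorm (f k - f₀) p ν * eLpNorm g q ν) atTop (𝓝 0) := by
    simpa using ENNReal.Tendsto.mul_const hlim (Or.inr (hg q).2.ne)
  refine tendsto_of_tendsto_of_tendsto_of_le_of_le tendsto_const_nhds hz (fun _ => zero_le)
    fun k => ?_
  refine le_of_eq_of_le ?_ (holder (f k - f₀) ((hf k).1.sub hf₀.1))
  congr 1
  funext x
  simp [inner_sub_left]

variable {n : ℕ}

theorem IsTestFunction.partialDeriv {φ : Eucl n → ℝ} (h : IsTestFunction φ) (i : Fin n) :
    IsTestFunction (partialDeriv i φ) := by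
  refine ⟨(h.1.fderiv_right (m := ∞) (by simp)).clm_apply contDiff_const, ?_⟩
  exact (h.2.fderiv (𝕜 := ℝ)).comp_left (g := fun L : Eucl n →L[ℝ] ℝ => L (stdVec i)) rfl

theorem IsTestFunction.memLp {φ : Eucl n → ℝ} (h : IsTestFunction φ) (p : ℝ≥0∞) : MemLp φ p :=
  h.1.continuous.memLp_of_hasCompactSupport h.2

theorem IsTestFunction.integrable_mul {φ u : Eucl n → ℝ} (h : IsTestFunction φ)
    (hu : LocallyIntegrable u) : Integrable fun x => u x * φ x := by
  simpa [mul_comm] using hu.integrable_smul_left_of_hasCompactSupport h.1.continuous h.2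

theorem integral_mul_partialDeriv {u φ : Eucl n → ℝ} (hu : ContDiff ℝ 1 u)
    (h : IsTestFunction φ) (i : Fin n) :
    ∫ x, u x * partialDeriv i φ x = -∫ x, partialDeriv i u x * φ x := by
  have hu' : Continuous (partialDeriv i u) :=
    (hu.continuous_fderiv (by simp)).clm_apply continuous_const
  exact integral_mul_fderiv_eq_neg_fderiv_mul_of_integrable
    (h.integrable_mul hu'.locallyIntegrable)
    ((h.partialDeriv i).integrable_mul hu.continuous.locallyIntegrable)
    (h.integrable_mul hu.continuous.locallyIntegrable)
    (fun x _ => hu.differentiable (by simp) x) (fun x _ => h.1.differentiable (by simp) x)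

theorem gradient_apply (φ : Eucl n → ℝ) (x : Eucl n) (i : Fin n) :
    gradient φ x i = partialDeriv i φ x := by
  rw [partialDeriv, ← inner_gradient_left, stdVec, EuclideanSpace.inner_single_right]
  simp

theorem IsTestFunction.memLp_gradient {φ : Eucl n → ℝ} (h : IsTestFunction φ) (p : ℝ≥0∞) :
    MemLp (gradient φ) p := by
  have hc : Continuous (gradient φ) := by
    have := h.1.continuous_fderiv (by simp)
    exact (InnerProductSpace.toDual ℝ (Eucl n)).symm.continuous.comp this
  refine hc.memLp_of_hasCompactSupport ?_
  exact (h.2.fderiv (𝕜 := ℝ)).comp_left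
    (g := (InnerProductSpace.toDual ℝ (Eucl n)).symm) (map_zero _)

/-- The Laplacian `∑ ∂ᵢ² φ`. -/
def laplace (φ : Eucl n → ℝ) (x : Eucl n) : ℝ := ∑ i, partialDeriv i (partialDeriv i φ) x

theorem IsTestFunction.laplace {φ : Eucl n → ℝ} (h : IsTestFunction φ) :
    IsTestFunction (laplace φ) := by
  have hi := fun i => (h.partialDeriv i).partialDeriv i
  refine ⟨ContDiff.sum fun i _ => (hi i).1, ?_⟩
  obtain ⟨R, hR⟩ : ∃ R : Fin n → ℝ, ∀ i x, R i ≤ ‖x‖ →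
      WeylBubble.partialDeriv i (WeylBubble.partialDeriv i φ) x = 0 := by
    choose R _ h using fun i => (hi i).2.exists_pos_le_norm
    exact ⟨R, h⟩
  refine HasCompactSupport.intro (isCompact_closedBall (0 : Eucl n) (∑ i, |R i|)) fun x hx => ?_
  refine Finset.sum_eq_zero fun i _ => hR i x ?_
  rw [mem_closedBall_zero_iff, not_le] at hx
  exact (le_abs_self _).trans ((Finset.single_le_sum (f := fun i => |R i|)
    (fun j _ => abs_nonneg _) (Finset.mem_univ i)).trans hx.le)

theorem integral_inner_gradient {u φ : Eucl n → ℝ} (hu : IsTestFunction u)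
    (h : IsTestFunction φ) :
    ∫ x, inner ℝ (gradient u x) (gradient φ x) = -∫ x, u x * laplace φ x := by
  have e : ∀ x, inner ℝ (gradient u x) (gradient φ x)
      = ∑ i, partialDeriv i u x * partialDeriv i φ x := fun x => by
    rw [PiLp.inner_apply]
    simp [gradient_apply, mul_comm]
  have hu1 : ContDiff ℝ 1 u := hu.1.of_le (by simp)
  simp only [e, laplace, Finset.mul_sum]
  rw [integral_finsetSum _ fun i _ =>
      (h.partialDeriv i).integrable_mul (hu.partialDeriv i).1.continuous.locallyIntegrable,
    integral_finsetSum _ fun i _ =>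
      ((h.partialDeriv i).partialDeriv i).integrable_mul hu.1.continuous.locallyIntegrable,
    ← Finset.sum_neg_distrib]
  refine Finset.sum_congr rfl fun i _ => ?_
  rw [integral_mul_partialDeriv hu1 (h.partialDeriv i) i, neg_neg]

theorem one_le_twoStar (hn : 3 ≤ n) : 1 ≤ twoStar n := by
  have : (3 : ℝ) ≤ n := by exact_mod_cast hn
  rw [twoStar, le_div_iff₀ (by linarith)]
  linarith

/-- The integration by parts is carried out on the smooth approximants, where it is classical; each
side then passes to the limit, in `L²` and in `L^{2*}` respectively. -/
theorem MemSigma.integral_mul_laplace (hn : 3 ≤ n) {V : Eucl n → ℝ} (hV : MemSigma V)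
    {φ : Eucl n → ℝ} (h : IsTestFunction φ) :
    ∫ x, V x * laplace φ x = -∫ x, |V x| ^ (twoStar n - 2) * V x * φ x := by
  obtain ⟨-, G, ⟨hVp, hG, u, hu, huV, huG⟩, heq⟩ := hV
  have hp : 1 ≤ ENNReal.ofReal (twoStar n) := by
    rw [← ENNReal.ofReal_one]; exact ENNReal.ofReal_le_ofReal (one_le_twoStar hn)
  have l1 := tendsto_integral_inner one_le_two (fun k => (hu k).memLp_gradient 2) hG
    h.memLp_gradient huG
  have l2 := tendsto_integral_inner hp (fun k => (hu k).memLp _) hVp h.laplace.memLp huV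
  have e : ∀ k, ∫ x, inner ℝ (gradient (u k) x) (gradient φ x)
      = -∫ x, inner ℝ (u k x) (laplace φ x) := fun k => by
    rw [integral_inner_gradient (hu k) h]
    simp [mul_comm]
  have l3 := tendsto_nhds_unique (l1.congr e) l2.neg
  rw [heq φ h] at l3
  rw [l3]
  simp [mul_comm]

end Distribution

/-! ## Polar coordinates -/

section Polar

variable {n : ℕ}

theorem integral_Ioi_eq_integral_exp (g : ℝ → ℝ) :
    ∫ r in Ioi (0 : ℝ), g r = ∫ t, Real.exp t * g (Real.exp t) := by
  have := integral_image_eq_integral_abs_deriv_smul (s := univ) MeasurableSet.univ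
    (fun t _ => (Real.hasDerivAt_exp t).hasDerivWithinAt) Real.exp_injective.injOn g
  rw [image_univ, Real.range_exp, setIntegral_univ] at this
  simpa [abs_of_pos (Real.exp_pos _)] using this

theorem integrableOn_Ioi_iff_exp (g : ℝ → ℝ) :
    IntegrableOn g (Ioi 0) ↔ Integrable fun t => Real.exp t * g (Real.exp t) := by
  have := integrableOn_image_iff_integrableOn_abs_deriv_smul (s := univ) MeasurableSet.univ
    (fun t _ => (Real.hasDerivAt_exp t).hasDerivWithinAt) Real.exp_injective.injOn g
  rw [image_univ, Real.range_exp, integrableOn_univ] at this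
  simpa [abs_of_pos (Real.exp_pos _)] using this

theorem exp_mul_exp_pow (hn : 0 < n) (t a : ℝ) :
    Real.exp t * (Real.exp t ^ (n - 1) * a) = Real.exp (n * t) * a := by
  rw [← mul_assoc, ← pow_succ', Nat.sub_add_cancel hn, ← Real.exp_nat_mul]

theorem nontrivial_eucl (hn : 0 < n) : Nontrivial (Eucl n) :=
  Module.nontrivial_of_finrank_pos (R := ℝ) (by simpa using hn)

theorem integrable_radial_iff (hn : 0 < n) (f : ℝ → ℝ) :
    Integrable (fun x : Eucl n => f ‖x‖) ↔
      Integrable fun t : ℝ => Real.exp (n * t) * f (Real.exp t) := by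
  have := nontrivial_eucl hn
  rw [integrable_fun_norm_addHaar, integrableOn_Ioi_iff_exp]
  simp only [finrank_euclideanSpace, Fintype.card_fin, smul_eq_mul, exp_mul_exp_pow hn]

/-- The constant is the area of the unit sphere; only `C ≠ 0` matters, since it is cancelled from
both sides of the equation. -/
theorem exists_integral_radial (hn : 0 < n) : ∃ C : ℝ, C ≠ 0 ∧ ∀ f : ℝ → ℝ,
    ∫ x : Eucl n, f ‖x‖ = C * ∫ t : ℝ, Real.exp (n * t) * f (Real.exp t) := by
  have := nontrivial_eucl hn
  refine ⟨n * (volume : Measure (Eucl n)).real (Metric.ball 0 1), ?_, fun f => ?_⟩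
  · refine mul_ne_zero (by exact_mod_cast hn.ne') ?_
    exact (ENNReal.toReal_pos (Metric.measure_ball_pos volume _ one_pos).ne'
      measure_ball_lt_top.ne).ne'
  · rw [integral_fun_norm_addHaar, integral_Ioi_eq_integral_exp]
    simp only [finrank_euclideanSpace, Fintype.card_fin, smul_eq_mul, exp_mul_exp_pow hn,
      nsmul_eq_mul, mul_assoc]

/-- The indicator of the failure of `P` is almost everywhere zero in the variable `t`, so polar
coordinates give it zero integral on `ℝⁿ`; no measurability of `P` is required. -/
theorem ae_radial (hn : 0 < n) {P : ℝ → Prop} (h : ∀ᵐ t : ℝ, P (Real.exp t)) :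
    ∀ᵐ x : Eucl n, P ‖x‖ := by
  classical
  set g : ℝ → ℝ := fun r => if P r then 0 else 1
  have h0 : (fun t : ℝ => Real.exp (n * t) * g (Real.exp t)) =ᵐ[volume] fun _ => 0 := by
    filter_upwards [h] with t ht
    simp [g, ht]
  obtain ⟨C, -, hC⟩ := exists_integral_radial hn
  have hint : Integrable (fun x : Eucl n => g ‖x‖) :=
    (integrable_radial_iff hn g).mpr ((integrable_congr h0).mpr (integrable_zero _ _ _))
  have hzero : ∫ x : Eucl n, g ‖x‖ = 0 := by
    rw [hC, integral_congr_ae h0]; simp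
  rw [integral_eq_zero_iff_of_nonneg (fun x => by simp only [g]; split_ifs <;> simp) hint] at hzero
  filter_upwards [hzero] with x hx
  by_contra hP
  simp [g, hP] at hx

/-! ### Radial test functions -/

/-- Radial functions are written through `‖x‖ ^ 2` rather than `‖x‖` so that the origin needs no
separate treatment. -/
theorem partialDeriv_comp_norm_sq {F : ℝ → ℝ} {x : Eucl n} {d : ℝ}
    (hF : HasDerivAt F d (‖x‖ ^ 2)) (i : Fin n) :
    partialDeriv i (fun x : Eucl n => F (‖x‖ ^ 2)) x = 2 * d * x i := by
  have h1 := hF.comp_hasFDerivAt x (hasStrictFDerivAt_norm_sq x).hasFDerivAt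
  have h2 := h1.fderiv
  rw [partialDeriv, show (fun x : Eucl n => F (‖x‖ ^ 2)) = F ∘ fun x : Eucl n => ‖x‖ ^ 2 from rfl,
    h2]
  simp [stdVec, EuclideanSpace.inner_single_right]
  ring

theorem partialDeriv_mul {f g : Eucl n → ℝ} {x : Eucl n} (hf : DifferentiableAt ℝ f x)
    (hg : DifferentiableAt ℝ g x) (i : Fin n) :
    partialDeriv i (fun x => f x * g x) x = partialDeriv i f x * g x + f x * partialDeriv i g x := by
  simp only [partialDeriv]
  rw [fderiv_fun_mul hf hg]
  simp
  ring

theorem partialDeriv_coord (i j : Fin n) (x : Eucl n) :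
    partialDeriv i (fun x : Eucl n => x j) x = if i = j then 1 else 0 := by
  have : (fun x : Eucl n => x j) = (EuclideanSpace.proj j : Eucl n →L[ℝ] ℝ) := rfl
  rw [partialDeriv, this, ContinuousLinearMap.fderiv]
  simp [stdVec, eq_comm]

theorem differentiable_coord (j : Fin n) : Differentiable ℝ fun x : Eucl n => x j :=
  (EuclideanSpace.proj j : Eucl n →L[ℝ] ℝ).differentiable

theorem partialDeriv_partialDeriv_comp_norm_sq {F F' F'' : ℝ → ℝ}
    (h1 : ∀ x : Eucl n, HasDerivAt F (F' (‖x‖ ^ 2)) (‖x‖ ^ 2))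
    (h2 : ∀ x : Eucl n, HasDerivAt F' (F'' (‖x‖ ^ 2)) (‖x‖ ^ 2)) (i j : Fin n) (x : Eucl n) :
    partialDeriv i (partialDeriv j fun x : Eucl n => F (‖x‖ ^ 2)) x
      = (if i = j then 2 * F' (‖x‖ ^ 2) else 0) + 4 * F'' (‖x‖ ^ 2) * (x i * x j) := by
  have e : partialDeriv j (fun x : Eucl n => F (‖x‖ ^ 2))
      = fun x => (2 * F' (‖x‖ ^ 2)) * x j := funext fun x => partialDeriv_comp_norm_sq (h1 x) j
  have hd : HasDerivAt (fun s => 2 * F' s) (2 * F'' (‖x‖ ^ 2)) (‖x‖ ^ 2) := (h2 x).const_mul 2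
  have hdiff : DifferentiableAt ℝ (fun x : Eucl n => 2 * F' (‖x‖ ^ 2)) x :=
    (hd.differentiableAt.comp x
      ((contDiff_norm_sq ℝ (n := 1) |>.differentiable (by simp)) x) :)
  rw [e, partialDeriv_mul hdiff (differentiable_coord j x), partialDeriv_coord,
    partialDeriv_comp_norm_sq hd]
  split_ifs <;> ring

/-- The function `s ↦ s^{-γ/2} ψ(log s / 2)`, extended by `0` to `s ≤ 0`. -/
def radialTest (γ : ℝ) (ψ : ℝ → ℝ) (s : ℝ) : ℝ :=
  if 0 < s then s ^ (-(γ / 2)) * ψ (Real.log s / 2) else 0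

theorem radialTest_exp (γ : ℝ) (ψ : ℝ → ℝ) (t : ℝ) :
    radialTest γ ψ (Real.exp (2 * t)) = Real.exp (-γ * t) * ψ t := by
  rw [radialTest, if_pos (Real.exp_pos _), Real.log_exp, ← Real.exp_mul]
  congr 2 <;> ring

theorem contDiff_radialTest (γ : ℝ) {ψ : ℝ → ℝ} (hψ : ContDiff ℝ ∞ ψ)
    (hc : HasCompactSupport ψ) : ContDiff ℝ ∞ (radialTest γ ψ) := by
  obtain ⟨R, hR, hsupp⟩ := exists_forall_le_abs_eq_zero hc
  refine contDiff_iff_contDiffAt.mpr fun s => ?_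
  rcases lt_or_ge 0 s with hs | hs
  · have h1 : ContDiffAt ℝ ∞ (fun s : ℝ => s ^ (-(γ / 2)) * ψ (Real.log s / 2)) s :=
      (contDiffAt_id.rpow_const_of_ne hs.ne').mul
        (hψ.contDiffAt.comp s ((Real.contDiffAt_log.mpr hs.ne').div_const 2))
    refine h1.congr_of_eventuallyEq ?_
    filter_upwards [Ioi_mem_nhds hs] with r hr
    exact if_pos hr
  · refine (contDiffAt_const (c := (0 : ℝ))).congr_of_eventuallyEq ?_
    filter_upwards [Iio_mem_nhds (hs.trans_lt (Real.exp_pos (-(2 * R))))] with r hr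
    rw [radialTest]
    split_ifs with hr0
    · have : Real.log r < -(2 * R) := by
        rw [← Real.log_exp (-(2 * R))]; exact Real.log_lt_log hr0 hr
      rw [hsupp _ (le_abs.mpr (Or.inr (by linarith))), mul_zero]
    · rfl

theorem isTestFunction_radialTest (γ : ℝ) {ψ : ℝ → ℝ} (hψ : ContDiff ℝ ∞ ψ)
    (hc : HasCompactSupport ψ) :
    IsTestFunction fun x : Eucl n => radialTest γ ψ (‖x‖ ^ 2) := by
  refine ⟨(contDiff_radialTest γ hψ hc).comp (contDiff_norm_sq ℝ), ?_⟩
  obtain ⟨R, hR, hsupp⟩ := exists_forall_le_abs_eq_zero hc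
  refine HasCompactSupport.intro (isCompact_closedBall (0 : Eucl n) (Real.exp R)) fun x hx => ?_
  rw [mem_closedBall_zero_iff, not_le] at hx
  have hx0 : 0 < ‖x‖ := (Real.exp_pos R).trans hx
  have hlog : R < Real.log ‖x‖ := (Real.lt_log_iff_exp_lt hx0).mpr hx
  show radialTest γ ψ (‖x‖ ^ 2) = 0
  rw [radialTest, if_pos (by positivity), Real.log_pow, hsupp, mul_zero]
  rw [le_abs]
  left
  push_cast
  linarith

/-- With `r = e^t`, the operator `r² Δ` on radial functions is `∂ₜ² + (n-2) ∂ₜ`; the weight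
`e^{-γt}` with `n - 2 = 2γ` removes the first-order term at the cost of `-γ²`. -/
theorem laplace_radialTest {γ : ℝ} (hγ : (n : ℝ) = 2 * γ + 2) {ψ : ℝ → ℝ}
    (hψ : ContDiff ℝ ∞ ψ) (hc : HasCompactSupport ψ) :
    ∃ L : ℝ → ℝ, (∀ x : Eucl n, laplace (fun x : Eucl n => radialTest γ ψ (‖x‖ ^ 2)) x = L ‖x‖) ∧
      ∀ t, L (Real.exp t)
        = Real.exp (-(γ + 2) * t) * (deriv (deriv ψ) t - γ ^ 2 * ψ t) := by
  set F := radialTest γ ψ with hF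
  have hFs : ContDiff ℝ ∞ F := contDiff_radialTest γ hψ hc
  have hFs' : ContDiff ℝ ∞ (deriv F) := (contDiff_infty_iff_deriv.mp hFs).2
  have hd1 : ∀ s, HasDerivAt F (deriv F s) s := fun s =>
    (hFs.differentiable (by simp) s).hasDerivAt
  have hd2 : ∀ s, HasDerivAt (deriv F) (deriv (deriv F) s) s := fun s =>
    (hFs'.differentiable (by simp) s).hasDerivAt
  refine ⟨fun r => 2 * n * deriv F (r ^ 2) + 4 * r ^ 2 * deriv (deriv F) (r ^ 2), fun x => ?_,
    fun t => ?_⟩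
  · rw [laplace]
    simp only [partialDeriv_partialDeriv_comp_norm_sq (fun x => hd1 (‖x‖ ^ 2))
      (fun x => hd2 (‖x‖ ^ 2)), if_true, Finset.sum_add_distrib, ← Finset.mul_sum]
    have : ∑ i, x i * x i = ‖x‖ ^ 2 := by
      rw [EuclideanSpace.norm_sq_eq]; simp [sq]
    rw [this]
    simp
    ring
  · have hexp : ∀ c t : ℝ, HasDerivAt (fun t => Real.exp (c * t)) (c * Real.exp (c * t)) t :=
      fun c t => by
        have := ((hasDerivAt_id t).const_mul c).exp
        convert! this using 1
        simp; ring
    have hψ' : ContDiff ℝ ∞ (deriv ψ) := (contDiff_infty_iff_deriv.mp hψ).2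
    have hdψ : ∀ s, HasDerivAt ψ (deriv ψ s) s := fun s =>
      (hψ.differentiable (by simp) s).hasDerivAt
    have hdψ' : ∀ s, HasDerivAt (deriv ψ) (deriv (deriv ψ) s) s := fun s =>
      (hψ'.differentiable (by simp) s).hasDerivAt
    -- `g1` and `g2` come from differentiating `F(e^{2t}) = e^{-γt} ψ(t)` once and twice; `g2 + 2γ
    -- g1` is the claim multiplied by `e^{2t}`.
    have g1 : ∀ t, deriv F (Real.exp (2 * t)) * (2 * Real.exp (2 * t))
        = Real.exp (-γ * t) * (deriv ψ t - γ * ψ t) := fun t => by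
      have a1 := (hd1 (Real.exp (2 * t))).comp t (hexp 2 t)
      have a2 := (hexp (-γ) t).mul (hdψ t)
      have a3 : (F ∘ fun t => Real.exp (2 * t)) = (fun t => Real.exp (-γ * t)) * ψ :=
        funext fun t => radialTest_exp γ ψ t
      rw [a3] at a1
      rw [a1.unique a2]
      ring
    have g2 : deriv (deriv F) (Real.exp (2 * t)) * (2 * Real.exp (2 * t)) * (2 * Real.exp (2 * t))
        + deriv F (Real.exp (2 * t)) * (2 * (2 * Real.exp (2 * t)))
        = Real.exp (-γ * t) * (deriv (deriv ψ) t - 2 * γ * deriv ψ t + γ ^ 2 * ψ t) := by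
      have a1 := ((hd2 (Real.exp (2 * t))).comp t (hexp 2 t)).mul ((hexp 2 t).const_mul 2)
      have a2 := (hexp (-γ) t).mul ((hdψ' t).sub ((hdψ t).const_mul γ))
      have a3 : ((deriv F ∘ fun t => Real.exp (2 * t)) * fun t => 2 * Real.exp (2 * t))
          = (fun t => Real.exp (-γ * t)) * (deriv ψ - fun t => γ * ψ t) := funext g1
      rw [a3] at a1
      have a4 := a1.unique a2
      simp only [Function.comp_apply, Pi.sub_apply] at a4
      rw [a4]
      ring
    have e1 : Real.exp t ^ 2 = Real.exp (2 * t) := by rw [← Real.exp_nat_mul]; norm_num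
    have e2 : Real.exp (-(γ + 2) * t) * Real.exp (2 * t) = Real.exp (-γ * t) := by
      rw [← Real.exp_add]; ring_nf
    simp only [e1]
    refine mul_right_cancel₀ (Real.exp_pos (2 * t)).ne' ?_
    rw [mul_right_comm _ _ (Real.exp (2 * t)), e2, hγ]
    linear_combination g2 + 2 * γ * g1 t

end Polar

/-! ## Radial solutions -/

section RadialSolution

variable {n : ℕ}

theorem abs_exp_mul_rpow (a y q : ℝ) :
    |Real.exp a * y| ^ q = Real.exp (a * q) * |y| ^ q := by
  rw [abs_mul, abs_of_pos (Real.exp_pos a), Real.mul_rpow (Real.exp_pos a).le (abs_nonneg y),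
    ← Real.exp_mul]

theorem locallyIntegrable_radial (hn : 0 < n) {v : ℝ → ℝ}
    (hv : LocallyIntegrable fun x : Eucl n => v ‖x‖) :
    LocallyIntegrable fun t : ℝ => Real.exp (n * t) * v (Real.exp t) := by
  rw [locallyIntegrable_iff]
  intro k hk
  obtain ⟨c, hc⟩ := hk.bddAbove
  have h1 : IntegrableOn (fun x : Eucl n => v ‖x‖) (Metric.closedBall 0 (Real.exp c)) :=
    hv.integrableOn_isCompact (isCompact_closedBall _ _)
  rw [← integrable_indicator_iff Metric.isClosed_closedBall.measurableSet] at h1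
  have h2 : Integrable fun x : Eucl n => (Iic (Real.exp c)).indicator v ‖x‖ := by
    convert! h1 using 2 with x
    simp [indicator]
  rw [integrable_radial_iff hn] at h2
  refine (h2.integrableOn (s := k)).congr_fun (fun t ht => ?_) hk.measurableSet
  simp [indicator, hc ht]

/-- Domination by `1 + |w|^p`, treating `|w| ≤ 1` and `|w| ≥ 1` separately. -/
theorem locallyIntegrable_nonlinearity {p : ℝ} (hp : 2 < p) {w : ℝ → ℝ}
    (hw : LocallyIntegrable w) (hint : Integrable fun t => |w t| ^ p) :
    LocallyIntegrable fun t => |w t| ^ (p - 2) * w t := by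
  have hm := hw.aestronglyMeasurable
  refine ((locallyIntegrable_const (1 : ℝ)).add hint.locallyIntegrable).mono
    (((hm.norm.aemeasurable.pow_const _).aestronglyMeasurable).mul hm) (ae_of_all _ fun t => ?_)
  have hpos : 0 ≤ |w t| ^ p := by positivity
  have hpos2 : 0 ≤ |w t| ^ (p - 2) := by positivity
  simp only [Pi.add_apply, Real.norm_eq_abs]
  rw [abs_mul, abs_of_nonneg hpos2, abs_of_nonneg (by linarith : 0 ≤ 1 + |w t| ^ p)]
  rcases le_total |w t| 1 with h | h
  · have h1 : |w t| ^ (p - 2) ≤ 1 := Real.rpow_le_one (abs_nonneg _) h (by linarith)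
    nlinarith [abs_nonneg (w t)]
  · rw [abs_rpow_eq_mul_sq hp, ← sq_abs]
    nlinarith [mul_nonneg hpos2 (mul_nonneg (abs_nonneg (w t)) (sub_nonneg.mpr h))]

/-- A distributional solution of `w'' = γ² w - |w|^{p-2} w` in `L^p(ℝ)` is a classical one. -/
theorem exists_classical_solution {γ p : ℝ} (hp : 2 < p) {w : ℝ → ℝ} (hw : LocallyIntegrable w)
    (hint : Integrable fun t => |w t| ^ p)
    (heq : ∀ ψ : ℝ → ℝ, ContDiff ℝ ∞ ψ → HasCompactSupport ψ →
      ∫ t, w t * (deriv (deriv ψ) t - γ ^ 2 * ψ t) = -∫ t, |w t| ^ (p - 2) * w t * ψ t) :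
    ∃ W z : ℝ → ℝ, w =ᵐ[volume] W ∧ (∀ t, HasDerivAt W (z t) t) ∧
      ∀ t, HasDerivAt z (γ ^ 2 * W t - |W t| ^ (p - 2) * W t) t := by
  have hN := locallyIntegrable_nonlinearity hp hw hint
  have hf : LocallyIntegrable fun t => γ ^ 2 * w t - |w t| ^ (p - 2) * w t :=
    (hw.smul (γ ^ 2)).sub hN
  obtain ⟨a, b, hab⟩ := ae_eq_of_integral_mul_deriv_deriv hw hf fun ψ hψ hψc => by
    have hψ' : ContDiff ℝ ∞ (deriv ψ) := (contDiff_infty_iff_deriv.mp hψ).2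
    have i1 := integrable_mul_test hw (hψ'.continuous_deriv (by simp)) hψc.deriv.deriv
    have i2 := (integrable_mul_test hw hψ.continuous hψc).const_mul (γ ^ 2)
    have i3 := integrable_mul_test hN hψ.continuous hψc
    have e1 : ∀ t, w t * (deriv (deriv ψ) t - γ ^ 2 * ψ t)
        = w t * deriv (deriv ψ) t - γ ^ 2 * (w t * ψ t) := fun t => by ring
    have e2 : ∀ t, (γ ^ 2 * w t - |w t| ^ (p - 2) * w t) * ψ t
        = γ ^ 2 * (w t * ψ t) - |w t| ^ (p - 2) * w t * ψ t := fun t => by ring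
    have h := heq ψ hψ hψc
    simp only [e1] at h
    rw [integral_sub i1 i2] at h
    simp only [e2]
    rw [integral_sub i2 i3]
    linarith
  set f := fun t => γ ^ 2 * w t - |w t| ^ (p - 2) * w t
  set z := fun s => b + ∫ r in (0 : ℝ)..s, f r
  have hzc : Continuous z := continuous_const.add (continuous_integral_of_locallyIntegrable hf)
  set W := fun t => a + ∫ s in (0 : ℝ)..t, z s with hW
  have hWd : ∀ t, HasDerivAt W (z t) t := fun t =>
    (intervalIntegral.integral_hasDerivAt_right (hzc.intervalIntegrable _ _)
      hzc.stronglyMeasurable.stronglyMeasurableAtFilter hzc.continuousAt).const_add a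
  have hWc : Continuous W := continuous_iff_continuousAt.mpr fun t => (hWd t).continuousAt
  have hgc : Continuous fun t => γ ^ 2 * W t - |W t| ^ (p - 2) * W t :=
    (continuous_const.mul hWc).sub
      ((hWc.abs.rpow_const fun t => Or.inr (by linarith)).mul hWc)
  refine ⟨W, z, hab, hWd, fun t => ?_⟩
  -- Replacing `w` by its continuous representative `W` under the integral makes the integrand
  -- continuous, so `z` is differentiable everywhere.
  have hz : z = fun s => b + ∫ r in (0 : ℝ)..s, (γ ^ 2 * W r - |W r| ^ (p - 2) * W r) := by
    funext s
    simp only [z]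
    congr 1
    refine intervalIntegral.integral_congr_ae ?_
    filter_upwards [hab] with r hr _
    simp only [f]
    rw [hr]
  rw [hz]
  exact (intervalIntegral.integral_hasDerivAt_right (hgc.intervalIntegrable _ _)
    hgc.stronglyMeasurable.stronglyMeasurableAtFilter hgc.continuousAt).const_add b

/-- The radial elements of `Σ` are the standard bubble, up to sign and dilation. -/
theorem MemSigma.eq_of_isRadial (hn : 3 ≤ n) {V : Eucl n → ℝ} (hV : MemSigma V)
    (hr : IsRadial V) :
    ∃ σ : ℝ, (σ = 1 ∨ σ = -1) ∧ ∃ s : ℝ, 0 < s ∧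
      V =ᵐ[volume] fun y =>
        σ * s ^ (((n : ℝ) - 2) / 2) * standardBubble n (s • y) := by
  obtain ⟨v, hv⟩ := hr
  have hn0 : 0 < n := by omega
  have hn3 : (3 : ℝ) ≤ n := by exact_mod_cast hn
  set γ : ℝ := ((n : ℝ) - 2) / 2 with hγ
  have hγ0 : 0 < γ := by rw [hγ]; linarith
  have hnγ : (n : ℝ) = 2 * γ + 2 := by rw [hγ]; ring
  set p := twoStar n with hp
  have hpγ : p = 2 + 2 / γ := by
    rw [hp, twoStar, hnγ]
    have : 2 * γ + 2 - 2 = 2 * γ := by ring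
    rw [this]
    field_simp
  -- This identity makes `e^{nt} |v(e^t)|^p = |w(t)|^p`, so that the critical norm carries over
  -- without weight.
  have hγp : γ * p = n := by rw [hpγ, hnγ]; field_simp
  have hp2 : 2 < p := by rw [hpγ]; linarith [div_pos two_pos hγ0]
  have hVp : MemLp V (ENNReal.ofReal p) := by
    obtain ⟨-, G, ⟨h, -⟩, -⟩ := hV
    exact h
  have hp1 : 1 ≤ ENNReal.ofReal p := by
    rw [← ENNReal.ofReal_one]; exact ENNReal.ofReal_le_ofReal (by linarith)
  have hvp : MemLp (fun x : Eucl n => v ‖x‖) (ENNReal.ofReal p) := (memLp_congr_ae hv).mp hVp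
  set w : ℝ → ℝ := fun t => Real.exp (γ * t) * v (Real.exp t) with hw
  have hint : Integrable fun t => |w t| ^ p := by
    have h1 := hvp.integrable_norm_rpow (by simp; linarith) (by simp)
    rw [ENNReal.toReal_ofReal (by linarith)] at h1
    have h2 := (integrable_radial_iff hn0 fun r => ‖v r‖ ^ p).mp h1
    refine h2.congr (ae_of_all _ fun t => ?_)
    simp only [hw, Real.norm_eq_abs]
    rw [abs_exp_mul_rpow, mul_right_comm, hγp]
  have hwl : LocallyIntegrable w := by
    have h1 := locallyIntegrable_radial hn0 (hvp.locallyIntegrable hp1)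
    have h2 : w = fun t => Real.exp ((γ - n) * t) • (Real.exp (n * t) * v (Real.exp t)) := by
      funext t
      simp only [hw, smul_eq_mul]
      rw [← mul_assoc, ← Real.exp_add]
      ring_nf
    rw [h2, locallyIntegrable_iff]
    intro k hk
    exact (h1.integrableOn_isCompact hk).continuousOn_mul
      (Continuous.continuousOn (by fun_prop)) hk
  have heq : ∀ ψ : ℝ → ℝ, ContDiff ℝ ∞ ψ → HasCompactSupport ψ →
      ∫ t, w t * (deriv (deriv ψ) t - γ ^ 2 * ψ t) = -∫ t, |w t| ^ (p - 2) * w t * ψ t := by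
    intro ψ hψ hψc
    obtain ⟨L, hL, hLt⟩ := laplace_radialTest hnγ hψ hψc
    obtain ⟨C, hC0, hC⟩ := exists_integral_radial hn0
    have key := hV.integral_mul_laplace hn (isTestFunction_radialTest γ hψ hψc)
    have e1 : ∫ x, V x * laplace (fun x : Eucl n => radialTest γ ψ (‖x‖ ^ 2)) x
        = C * ∫ t, w t * (deriv (deriv ψ) t - γ ^ 2 * ψ t) := by
      have : (fun x => V x * laplace (fun x : Eucl n => radialTest γ ψ (‖x‖ ^ 2)) x)
          =ᵐ[volume] fun x => v ‖x‖ * L ‖x‖ := by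
        filter_upwards [hv] with x hx
        rw [hx, hL]
      rw [integral_congr_ae this, hC fun r => v r * L r]
      congr 2
      funext t
      rw [hLt]
      simp only [hw]
      have : Real.exp (n * t) * Real.exp (-(γ + 2) * t) = Real.exp (γ * t) := by
        rw [← Real.exp_add, hnγ]; ring_nf
      rw [← this]
      ring
    have e2 : ∫ x, |V x| ^ (p - 2) * V x * radialTest γ ψ (‖x‖ ^ 2)
        = C * ∫ t, |w t| ^ (p - 2) * w t * ψ t := by
      have : (fun x : Eucl n => |V x| ^ (p - 2) * V x * radialTest γ ψ (‖x‖ ^ 2))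
          =ᵐ[volume] fun x => |v ‖x‖| ^ (p - 2) * v ‖x‖ * radialTest γ ψ (‖x‖ ^ 2) := by
        filter_upwards [hv] with x hx
        rw [hx]
      rw [integral_congr_ae this, hC fun r => |v r| ^ (p - 2) * v r * radialTest γ ψ (r ^ 2)]
      congr 2
      funext t
      have e : Real.exp t ^ 2 = Real.exp (2 * t) := by rw [← Real.exp_nat_mul]; norm_num
      rw [e, radialTest_exp, hw]
      simp only [abs_exp_mul_rpow]
      have : Real.exp (n * t) * Real.exp (-γ * t)
          = Real.exp (γ * t * (p - 2)) * Real.exp (γ * t) := by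
        rw [← Real.exp_add, ← Real.exp_add, ← hγp]; ring_nf
      linear_combination (|v (Real.exp t)| ^ (p - 2) * v (Real.exp t) * ψ t) * this
    rw [e1, e2, ← mul_neg] at key
    exact mul_left_cancel₀ hC0 key
  obtain ⟨W, z, hwW, hW, hz⟩ := exists_classical_solution hp2 hwl hint heq
  have hVW : V =ᵐ[volume] fun x => ‖x‖ ^ (-γ) * W (Real.log ‖x‖) := by
    have h1 : ∀ᵐ x : Eucl n, v ‖x‖ = ‖x‖ ^ (-γ) * W (Real.log ‖x‖) := by
      refine ae_radial hn0 (P := fun r => v r = r ^ (-γ) * W (Real.log r)) ?_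
      filter_upwards [hwW] with t ht
      rw [Real.log_exp, ← ht, ← Real.exp_mul, hw, ← mul_assoc, ← Real.exp_add]
      ring_nf
      simp
    filter_upwards [hv, h1] with x h2 h3
    rw [h2, h3]
  have hWne : ∃ t, W t ≠ 0 := by
    by_contra! hcon
    refine hV.1 ?_
    filter_upwards [hVW] with x hx
    rw [hx, hcon, mul_zero]; rfl
  have hWint : Integrable fun t => |W t| ^ p := by
    refine hint.congr ?_
    filter_upwards [hwW] with t ht
    rw [ht]
  obtain ⟨σ, hσ, a, b, ha, hb, hab, hWab⟩ := eq_of_integrable_abs_rpow hγ0 hpγ hW hz hWint hWne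
  -- Up to sign `V = (a r² + b)^{-γ} = b^{-γ} (1 + (a/b) r²)^{-γ}`, and `ab = 1/(n(n-2))` gives `a/b
  -- = s²/(n(n-2))` for `s = 1/b`.
  refine ⟨σ, hσ, 1 / b, by positivity, ?_⟩
  have hx0 : ∀ᵐ x : Eucl n, 0 < ‖x‖ :=
    ae_radial hn0 (P := fun r => 0 < r) (ae_of_all _ fun t => Real.exp_pos t)
  filter_upwards [hVW, hx0] with x hx hpos
  have hxinv : Real.exp (-Real.log ‖x‖) = ‖x‖⁻¹ := by rw [Real.exp_neg, Real.exp_log hpos]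
  rw [hx, hWab, Real.exp_log hpos, hxinv, standardBubble, ← hγ, norm_smul]
  rw [mul_left_comm, mul_assoc]
  congr 1
  have hb1 : (1 / b : ℝ) ^ γ = b ^ (-γ) := by
    rw [one_div, Real.inv_rpow hb.le, Real.rpow_neg hb.le]
  rw [hb1, ← Real.mul_rpow hpos.le (by positivity)]
  have hnn : (n : ℝ) * (n - 2) = 4 * γ * (γ + 1) := by rw [hnγ]; ring
  rw [hnn, ← Real.mul_rpow hb.le (by positivity)]
  congr 1
  have ha' : a = 1 / (4 * γ * (γ + 1)) / b := by rw [← hab]; field_simp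
  rw [ha', Real.norm_eq_abs, abs_of_pos (by positivity : 0 < 1 / b)]
  field_simp
  ring

end RadialSolution

/-! ## The integrals attached to the standard bubble -/

section Bubble

variable {n : ℕ}

/-- Whatever representative the choice picks, the fundamental lemma of the calculus of variations
identifies it almost everywhere. As `u` need only agree almost everywhere with a `C¹` function, the
lemma can be iterated for second derivatives. -/
theorem weakPartial_ae_eq {u U : Eucl n → ℝ} (hu : u =ᵐ[volume] U) (hU : ContDiff ℝ 1 U)
    (i : Fin n) : weakPartial i u =ᵐ[volume] partialDeriv i U := by
  have hUl : LocallyIntegrable u :=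
    (locallyIntegrable_congr hu).mpr hU.continuous.locallyIntegrable
  have hdl : LocallyIntegrable (partialDeriv i U) :=
    ((hU.continuous_fderiv (by simp)).clm_apply continuous_const).locallyIntegrable
  have hw : ∃ g, IsWeakPartial i u g := ⟨partialDeriv i U, hUl, hdl, fun φ hφ => by
    rw [← integral_mul_partialDeriv hU hφ i]
    refine integral_congr_ae ?_
    filter_upwards [hu] with x hx
    rw [hx]⟩
  rw [weakPartial, dif_pos hw]
  obtain ⟨-, hgl, hg⟩ := hw.choose_spec
  refine ae_eq_of_integral_contDiff_smul_eq hgl hdl fun φ hφ hφc => ?_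
  have h1 := hg φ ⟨hφ, hφc⟩
  have h2 := integral_mul_partialDeriv hU ⟨hφ, hφc⟩ i
  have h3 : ∫ x, u x * partialDeriv i φ x = ∫ x, U x * partialDeriv i φ x := by
    refine integral_congr_ae ?_
    filter_upwards [hu] with x hx
    rw [hx]
  simp only [smul_eq_mul, mul_comm (φ _)]
  linarith

theorem hasDerivAt_one_add_rpow {κ s : ℝ} (hs : 0 < 1 + κ * s) (c e : ℝ) :
    HasDerivAt (fun s => c * (1 + κ * s) ^ e) (c * e * κ * (1 + κ * s) ^ (e - 1)) s := by
  have h1 : HasDerivAt (fun s => 1 + κ * s) κ s := by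
    simpa using ((hasDerivAt_id s).const_mul κ).const_add 1
  convert! (h1.rpow_const (p := e) (Or.inl hs.ne')).const_mul c using 1
  ring

theorem one_add_mul_norm_sq_pos {κ : ℝ} (hκ : 0 < κ) (x : Eucl n) : 0 < 1 + κ * ‖x‖ ^ 2 := by
  positivity

theorem contDiff_one_add_rpow {κ : ℝ} (hκ : 0 < κ) (c e : ℝ) :
    ContDiff ℝ ∞ fun x : Eucl n => c * (1 + κ * ‖x‖ ^ 2) ^ e :=
  contDiff_const.mul ((contDiff_const.add (contDiff_const.mul (contDiff_norm_sq ℝ))).rpow_const_of_ne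
    fun x => (one_add_mul_norm_sq_pos hκ x).ne')

theorem contDiff_partialDeriv {f : Eucl n → ℝ} (hf : ContDiff ℝ ∞ f) (i : Fin n) :
    ContDiff ℝ ∞ (partialDeriv i f) :=
  (hf.fderiv_right (m := ∞) (by simp)).clm_apply contDiff_const

theorem weylIntegrand_ae_eq {V : Eucl n → ℝ} {κ c γ : ℝ} (hκ : 0 < κ)
    (hγ : γ = ((n : ℝ) - 2) / 2)
    (hV : V =ᵐ[volume] fun x => c * (1 + κ * ‖x‖ ^ 2) ^ (-γ)) (i α j β : Fin n) :
    weylIntegrand V i α j β =ᵐ[volume] fun x =>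
      x α * x β * ((if i = j then 2 * (c * -γ * κ * (1 + κ * ‖x‖ ^ 2) ^ (-γ - 1)) else 0)
        + 4 * (c * -γ * κ * (-γ - 1) * κ * (1 + κ * ‖x‖ ^ 2) ^ (-γ - 1 - 1)) * (x i * x j)) *
      (γ * (c * (1 + κ * ‖x‖ ^ 2) ^ (-γ))
        + 2 * (c * -γ * κ * (1 + κ * ‖x‖ ^ 2) ^ (-γ - 1)) * ‖x‖ ^ 2) := by
  set U : Eucl n → ℝ := fun x => c * (1 + κ * ‖x‖ ^ 2) ^ (-γ) with hU
  have hUs : ContDiff ℝ ∞ U := contDiff_one_add_rpow hκ c _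
  have hU1 : ContDiff ℝ 1 U := hUs.of_le (by simp)
  have h1 := fun l => weakPartial_ae_eq hV hU1 l
  have h2 := weakPartial_ae_eq (h1 j) ((contDiff_partialDeriv hUs j).of_le (by simp)) i
  have hd1 : ∀ x : Eucl n, HasDerivAt (fun s => c * (1 + κ * s) ^ (-γ))
      (c * -γ * κ * (1 + κ * ‖x‖ ^ 2) ^ (-γ - 1)) (‖x‖ ^ 2) := fun x =>
    hasDerivAt_one_add_rpow (one_add_mul_norm_sq_pos hκ x) c _
  have hd2 : ∀ x : Eucl n, HasDerivAt (fun s => c * -γ * κ * (1 + κ * s) ^ (-γ - 1))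
      (c * -γ * κ * (-γ - 1) * κ * (1 + κ * ‖x‖ ^ 2) ^ (-γ - 1 - 1)) (‖x‖ ^ 2) := fun x =>
    hasDerivAt_one_add_rpow (one_add_mul_norm_sq_pos hκ x) _ _
  filter_upwards [hV, h2, ae_all_iff.mpr h1] with x hx hx2 hx1
  have e1 := partialDeriv_partialDeriv_comp_norm_sq
    (F' := fun s => c * -γ * κ * (1 + κ * s) ^ (-γ - 1))
    (F'' := fun s => c * -γ * κ * (-γ - 1) * κ * (1 + κ * s) ^ (-γ - 1 - 1)) hd1 hd2 i j x
  have e2 : ∀ l, x l * weakPartial l V x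
      = 2 * (c * -γ * κ * (1 + κ * ‖x‖ ^ 2) ^ (-γ - 1)) * (x l * x l) := fun l => by
    rw [hx1 l]
    have := partialDeriv_comp_norm_sq (hd1 x) l
    rw [hU, this]
    ring
  have e3 : ∑ i, x i * x i = ‖x‖ ^ 2 := by
    rw [EuclideanSpace.norm_sq_eq]; simp [sq]
  rw [weylIntegrand, hx2, e1, hx, ← hγ]
  simp only [e2]
  rw [← Finset.mul_sum, e3]

theorem integrable_one_add_mul_norm_sq_rpow {κ r : ℝ} (hκ : 0 < κ) (hr : (n : ℝ) < r) :
    Integrable fun x : Eucl n => (1 + κ * ‖x‖ ^ 2) ^ (-r / 2) := by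
  have h1 := integrable_rpow_neg_one_add_norm_sq (E := Eucl n) (μ := volume) (r := r)
    (by simpa using hr)
  have h2 := h1.comp_smul (R := √κ) (Real.sqrt_pos.mpr hκ).ne'
  refine h2.congr (ae_of_all _ fun x => ?_)
  simp only
  rw [norm_smul, mul_pow, Real.norm_eq_abs, sq_abs, Real.sq_sqrt hκ.le]

/-- Each factor is compared with `q = 1 + κ|x|²`: the coordinates give at most `q/κ`, the Hessian
`q^{-γ-1}` and the last factor `q^{-γ}`, up to constants. The product is `O(q^{-2γ})`, integrable
since `4γ = 2(n-2) > n` when `n ≥ 5`. -/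
theorem integrable_bubble_integrand (hn : 5 ≤ n) {κ c γ : ℝ} (hκ : 0 < κ)
    (hγ : γ = ((n : ℝ) - 2) / 2) (i α j β : Fin n) :
    Integrable fun x : Eucl n =>
      x α * x β * ((if i = j then 2 * (c * -γ * κ * (1 + κ * ‖x‖ ^ 2) ^ (-γ - 1)) else 0)
        + 4 * (c * -γ * κ * (-γ - 1) * κ * (1 + κ * ‖x‖ ^ 2) ^ (-γ - 1 - 1)) * (x i * x j)) *
      (γ * (c * (1 + κ * ‖x‖ ^ 2) ^ (-γ))
        + 2 * (c * -γ * κ * (1 + κ * ‖x‖ ^ 2) ^ (-γ - 1)) * ‖x‖ ^ 2) := by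
  have hn5 : (5 : ℝ) ≤ n := by exact_mod_cast hn
  have hγ0 : 0 < γ := by rw [hγ]; linarith
  have hint : Integrable fun x : Eucl n => (1 + κ * ‖x‖ ^ 2) ^ (-(4 * γ) / 2) :=
    integrable_one_add_mul_norm_sq_rpow hκ (by rw [hγ]; linarith)
  set a := |c| * γ with ha
  have ha0 : 0 ≤ a := by positivity
  refine (hint.const_mul ((2 * a + 4 * a * (γ + 1)) * (3 * a))).mono'
    (Continuous.aestronglyMeasurable ?_) (ae_of_all _ fun x => ?_)
  · have hp : ∀ e : ℝ, Continuous fun x : Eucl n => (1 + κ * ‖x‖ ^ 2) ^ e := fun e => by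
      simpa using (contDiff_one_add_rpow (n := n) hκ 1 e).continuous
    have h0 := hp (-γ)
    have h1 := hp (-γ - 1)
    have h2 := hp (-γ - 1 - 1)
    split_ifs <;> fun_prop
  · have hq : 0 < 1 + κ * ‖x‖ ^ 2 := one_add_mul_norm_sq_pos hκ x
    have hxq : κ * ‖x‖ ^ 2 ≤ 1 + κ * ‖x‖ ^ 2 := by linarith
    have hcoord : ∀ k l, |x k * x l| ≤ ‖x‖ ^ 2 := fun k l => by
      rw [abs_mul, sq]
      exact mul_le_mul (PiLp.norm_apply_le x k) (PiLp.norm_apply_le x l) (abs_nonneg _)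
        (norm_nonneg _)
    have e1 : (1 + κ * ‖x‖ ^ 2) ^ (-γ - 1) = (1 + κ * ‖x‖ ^ 2) ^ (-γ) / (1 + κ * ‖x‖ ^ 2) :=
      Real.rpow_sub_one hq.ne' _
    have e2 : (1 + κ * ‖x‖ ^ 2) ^ (-γ - 1 - 1)
        = (1 + κ * ‖x‖ ^ 2) ^ (-γ) / (1 + κ * ‖x‖ ^ 2) / (1 + κ * ‖x‖ ^ 2) := by
      rw [Real.rpow_sub_one hq.ne', e1]
    have e3 : (1 + κ * ‖x‖ ^ 2) ^ (-(4 * γ) / 2)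
        = (1 + κ * ‖x‖ ^ 2) ^ (-γ) * (1 + κ * ‖x‖ ^ 2) ^ (-γ) := by
      rw [← Real.rpow_add hq]; ring_nf
    have hP : 0 < (1 + κ * ‖x‖ ^ 2) ^ (-γ) := Real.rpow_pos_of_pos hq _
    rw [e1, e2, e3]
    generalize (1 + κ * ‖x‖ ^ 2) ^ (-γ) = P at hP
    generalize hqd : 1 + κ * ‖x‖ ^ 2 = q at *
    have hX : ‖x‖ ^ 2 ≤ q / κ := by rw [le_div_iff₀ hκ]; linarith
    have b1 : |if i = j then 2 * (c * -γ * κ * (P / q)) else 0| ≤ 2 * a * κ * (P / q) := by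
      split_ifs
      · rw [abs_mul, abs_mul, abs_mul, abs_mul, abs_neg, abs_of_pos hγ0, abs_of_pos hκ,
          abs_of_pos (div_pos hP hq), abs_two]
        exact le_of_eq (by rw [ha]; ring)
      · rw [abs_zero]; positivity
    have b2 : |4 * (c * -γ * κ * (-γ - 1) * κ * (P / q / q)) * (x i * x j)|
        ≤ 4 * a * (γ + 1) * κ * (P / q) := by
      have : 4 * (c * -γ * κ * (-γ - 1) * κ * (P / q / q))
          = c * (4 * γ * (γ + 1) * κ ^ 2 * (P / q / q)) := by ring
      rw [this, abs_mul, abs_mul, abs_of_pos (by positivity : 0 < 4 * γ * (γ + 1) * κ ^ 2 *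
        (P / q / q))]
      calc |c| * (4 * γ * (γ + 1) * κ ^ 2 * (P / q / q)) * |x i * x j|
          ≤ |c| * (4 * γ * (γ + 1) * κ ^ 2 * (P / q / q)) * (q / κ) := by
            gcongr
            exact (hcoord i j).trans hX
        _ = 4 * a * (γ + 1) * κ * (P / q) := by rw [ha]; field_simp
    have b3 : |γ * (c * P) + 2 * (c * -γ * κ * (P / q)) * ‖x‖ ^ 2| ≤ 3 * a * P := by
      have hr0 : 0 ≤ κ * ‖x‖ ^ 2 / q := by positivity
      have hr1 : κ * ‖x‖ ^ 2 / q ≤ 1 := (div_le_one hq).mpr hxq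
      have : γ * (c * P) + 2 * (c * -γ * κ * (P / q)) * ‖x‖ ^ 2
          = c * (γ * P) * (1 - 2 * (κ * ‖x‖ ^ 2 / q)) := by ring
      rw [this, abs_mul, abs_mul, abs_of_pos (mul_pos hγ0 hP)]
      have h3 : |1 - 2 * (κ * ‖x‖ ^ 2 / q)| ≤ 3 := by
        rw [abs_le]; constructor <;> linarith
      calc |c| * (γ * P) * |1 - 2 * (κ * ‖x‖ ^ 2 / q)| ≤ |c| * (γ * P) * 3 := by gcongr
        _ = 3 * a * P := by rw [ha]; ring
    rw [Real.norm_eq_abs, abs_mul, abs_mul]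
    calc _ ≤ q / κ * (2 * a * κ * (P / q) + 4 * a * (γ + 1) * κ * (P / q)) * (3 * a * P) := by
          gcongr
          · exact (hcoord α β).trans hX
          · exact (abs_add_le _ _).trans (add_le_add b1 b2)
      _ = (2 * a + 4 * a * (γ + 1)) * (3 * a) * (P * P) := by
          field_simp

/-- The cancellation takes place only after summation, so integrability of every term is what allows
the sum to move inside the integral. -/
theorem sum_mul_integral_eq_zero {X : Type*} [MeasurableSpace X] {ν : Measure X}
    {W : Fin n → Fin n → Fin n → Fin n → ℝ} {f : Fin n → Fin n → Fin n → Fin n → X → ℝ}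
    (hf : ∀ i α j β, Integrable (f i α j β) ν)
    (h : ∀ᵐ x ∂ν, ∑ i, ∑ α, ∑ j, ∑ β, W i α j β * f i α j β x = 0) :
    ∑ i, ∑ α, ∑ j, ∑ β, W i α j β * ∫ x, f i α j β x ∂ν = 0 := by
  have i1 := fun i α j β => (hf i α j β).const_mul (W i α j β)
  have i2 := fun i α j => integrable_finsetSum Finset.univ fun β _ => i1 i α j β
  have i3 := fun i α => integrable_finsetSum Finset.univ fun j _ => i2 i α j
  have i4 := fun i => integrable_finsetSum Finset.univ fun α _ => i3 i α
  have key := integral_eq_zero_of_ae h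
  rw [integral_finsetSum _ fun i _ => i4 i] at key
  rw [← key]
  refine Finset.sum_congr rfl fun i _ => ?_
  rw [integral_finsetSum _ fun α _ => i3 i α]
  refine Finset.sum_congr rfl fun α _ => ?_
  rw [integral_finsetSum _ fun j _ => i2 i α j]
  refine Finset.sum_congr rfl fun j _ => ?_
  rw [integral_finsetSum _ fun β _ => i1 i α j β]
  exact Finset.sum_congr rfl fun β _ => (integral_const_mul _ _).symm

theorem weylProduct_eq_zero_of_bubble (hn : 5 ≤ n)
    {M : Type*} [MetricSpace M] [ChartedSpace (Eucl n) M] [IsManifold (𝓡 n) ∞ M]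
    [RiemannianBundle (fun x : M => TangentSpace (𝓡 n) x)]
    {V : Eucl n → ℝ} {κ c : ℝ} (hκ : 0 < κ)
    (hV : V =ᵐ[volume] fun x => c * (1 + κ * ‖x‖ ^ 2) ^ (-(((n : ℝ) - 2) / 2)))
    (x₀ : M) (ι : Eucl n ≃ₗᵢ[ℝ] TangentSpace (𝓡 n) x₀) : weylProduct x₀ ι V = 0 := by
  have hae := weylIntegrand_ae_eq hκ rfl hV
  rw [weylProduct]
  refine mul_eq_zero_of_right _ (sum_mul_integral_eq_zero
    (W := fun i α j β => weylTensor x₀ (ι (stdVec i)) (ι (stdVec α)) (ι (stdVec j)) (ι (stdVec β)))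
    (f := fun i α j β => weylIntegrand V i α j β) (fun i α j β =>
    (integrable_congr (hae i α j β)).mpr (integrable_bubble_integrand hn hκ rfl i α j β)) ?_)
  filter_upwards [ae_all_iff.mpr fun i => ae_all_iff.mpr fun α => ae_all_iff.mpr fun j =>
    ae_all_iff.mpr fun β => hae i α j β] with x hx
  simp only [hx]
  -- The factor `(n-2)/2 V + x^l ∂_l V` does not depend on the indices; it is pulled out of the sum
  -- as `S`.
  generalize _ + 2 * _ * ‖x‖ ^ 2 = S
  have h := congrArg (· * S) (sum_weylTensor_radial (by omega) x₀ ι x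
    (2 * (c * -(((n : ℝ) - 2) / 2) * κ * (1 + κ * ‖x‖ ^ 2) ^ (-(((n : ℝ) - 2) / 2) - 1)))
    (4 * (c * -(((n : ℝ) - 2) / 2) * κ * (-(((n : ℝ) - 2) / 2) - 1) * κ *
      (1 + κ * ‖x‖ ^ 2) ^ (-(((n : ℝ) - 2) / 2) - 1 - 1))))
  simpa only [Finset.sum_mul, zero_mul, mul_assoc] using h

end Bubble

end WeylBubble

end

theorem proposition3p3 {n : ℕ} (hn : 5 ≤ n)
    {M : Type*} [MetricSpace M] [ChartedSpace (WeylBubble.Eucl n) M] [IsManifold (𝓡 n) ∞ M]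
    [CompactSpace M] [ConnectedSpace M]
    [RiemannianBundle (fun x : M => TangentSpace (𝓡 n) x)]
    [IsContMDiffRiemannianBundle (𝓡 n) ∞ (WeylBubble.Eucl n) (fun x : M => TangentSpace (𝓡 n) x)]
    [IsRiemannianManifold (𝓡 n) M]
    [MeasurableSpace M] [BorelSpace M]
    (r : ℝ) (hr : 0 < r) (hr' : ENNReal.ofReal r < WeylBubble.injectivityRadius n M)
    (χ : ℝ → ℝ) (hχ : ContDiff ℝ ∞ χ) (hχ1 : ∀ t, |t| ≤ r / 2 → χ t = 1)
    (hχ0 : ∀ t, r ≤ |t| → χ t = 0)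
    (B : ℝ → M → ℝ) (x : ℝ → M) (μ : ℝ → ℝ) (V : WeylBubble.Eucl n → ℝ) (x₀ : M)
    (hB : WeylBubble.IsBubbleFamily r χ B x μ V x₀) :
    ((∀ u v w z : TangentSpace (𝓡 n) x₀, WeylBubble.weylTensor x₀ u v w z = 0) →
      ∀ ι : WeylBubble.Eucl n ≃ₗᵢ[ℝ] TangentSpace (𝓡 n) x₀,
        WeylBubble.weylProduct x₀ ι V = 0) ∧
    (WeylBubble.IsRadial V →
      (∃ σ : ℝ, (σ = 1 ∨ σ = -1) ∧ ∃ s : ℝ, 0 < s ∧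
        V =ᵐ[volume] fun y =>
          σ * s ^ (((n : ℝ) - 2) / 2) * WeylBubble.standardBubble n (s • y)) ∧
      (∀ i α j β : Fin n, Integrable (WeylBubble.weylIntegrand V i α j β)) ∧
      ∀ ι : WeylBubble.Eucl n ≃ₗᵢ[ℝ] TangentSpace (𝓡 n) x₀,
        WeylBubble.weylProduct x₀ ι V = 0) := by
  refine ⟨fun hW ι => by simp [WeylBubble.weylProduct, hW], fun hrad => ?_⟩
  obtain ⟨σ, hσ, s, hs, hV⟩ := hB.memSigma.eq_of_isRadial (by omega) hrad
  have hn5 : (5 : ℝ) ≤ n := by exact_mod_cast hn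
  have hκ : 0 < s ^ 2 / ((n : ℝ) * (n - 2)) := by
    have : 0 < (n : ℝ) - 2 := by linarith
    positivity
  have hV' : V =ᵐ[volume] fun x => (σ * s ^ (((n : ℝ) - 2) / 2)) *
      (1 + s ^ 2 / ((n : ℝ) * (n - 2)) * ‖x‖ ^ 2) ^ (-(((n : ℝ) - 2) / 2)) := by
    filter_upwards [hV] with x hx
    rw [hx, WeylBubble.standardBubble, norm_smul, mul_pow, Real.norm_eq_abs, sq_abs]
    ring_nf
  exact ⟨⟨σ, hσ, s, hs, hV⟩, fun i α j β =>
    (integrable_congr (WeylBubble.weylIntegrand_ae_eq hκ rfl hV' i α j β)).mpr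
      (WeylBubble.integrable_bubble_integrand hn hκ rfl i α j β),
    fun ι => WeylBubble.weylProduct_eq_zero_of_bubble hn hκ hV' x₀ ι⟩
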